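/- Let $0<q<1$, $0<aq<1$, $0<bq<1$, $0<cq<1$ and $d<0$. For a function $f(x,y)$ put $$D_q^1f=\frac{f(qx,y)-f(x,y)}{(q-1)x},\quad D_q^2f=\frac{f(x,qy)-f(x,y)}{(q-1)y},\quad D_{q^{-1}}^1f=\frac{q\,(f(x,y)-f(x/q,y))}{(q-1)x},\quad D_{q^{-1}}^2f=\frac{q\,(f(x,y)-f(x,y/q))}{(q-1)y},$$ $[z]_q=\frac{q^z-1}{q-1}$ and $(x;q)_k=\prod_{r=0}^{k-1}(1-xq^r)$. Consider, for $n\ge 0$, the partial $q$-difference equation (for $xy\neq0$) $$a_{11}\sqrt q\,D_q^1D_{q^{-1}}^1u+a_{22}\sqrt q\,D_q^2D_{q^{-1}}^2u+a_{12a}D_q^1D_q^2u+a_{12d}D_{q^{-1}}^1D_{q^{-1}}^2u+b_1D_q^1u+b_2D_q^2u+\lambda_nu=0\qquad(\mathrm E_n)$$ of the bivariate big $q$-Jacobi polynomials, where $a_{11}=\sqrt q\,(dq-x)(acq^2-x)$, $a_{22}=\sqrt q\,(aq-y)(dq-y)$, $a_{12a}=acq^4(d-bx)(1-y)$, $a_{12d}=(dq-x)(aq-y)$,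 $$b_1=\frac{q\,\bigl(q(d-acdq^2+acq(1+bq(x-1)))-x\bigr)}{q-1},\quad b_2=\frac{q\,\bigl(dq+aq(1-dq+bcq^2(y-1))-y\bigr)}{q-1},\quad \lambda_n=q^{2-n}[n]_q\frac{1-abcq^{n+2}}{q-1}.$$ (1) There is exactly one family of column vectors $\mathbb P_n=(P^n_{n,0},P^n_{n-1,1},\dots,P^n_{0,n})^T$, $n\ge0$, of real polynomials in $x,y$ such that $P^n_{n-k,k}=x^{n-k}y^k+{}$terms of total degree less than $n$, and every entry of $\mathbb P_n$ solves $(\mathrm E_n)$. (2) With $x_1=x$, $x_2=y$, $\mathbb P_{-1}=0$, for each $n\ge 0$ and $j=1,2$ there are unique real matrices $A_{n,j}$, $B_{n,j}$, $C_{n,j}$ of sizes $(n+1)\times(n+2)$, $(n+1)\times(n+1)$, $(n+1)\times n$ with $$x_j\mathbb P_n=A_{n,j}\mathbb P_{n+1}+B_{n,j}\mathbb P_n+C_{n,j}\mathbb P_{n-1}.$$ Here $A_{n,j}=L_{n,j}$, where $(L_{n,1})_{k,l}=\delta_{k,l}$ and $(L_{n,2})_{k,l}=\delta_{k+1,l}$.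 Put $\Delta_m=abcq^m-1$ and $N_n=\Delta_{2n}\Delta_{2n+1}^2\Delta_{2n+2}$. The entries of the other matrices in row $i$ and column $j$ (numbered from $1$) are as follows. $B_{n,1}$: for $i=j$, $$\frac{dq^{-i+n+2}\bigl(acq^{2i-1}(q^{-i+n+1}(b(acq^{i+n+1}+q^{-i+n+2}-q-1)-q-1)+1)+1\bigr)+acq^{n+2}\bigl(-b(q+1)q^{n-i}(acq^{2i}+q)+ab(b+1)cq^{2n+2}+b+1\bigr)}{\Delta_{2n+1}\Delta_{2n+3}};$$ for $i=j+1$, $$-\frac{(q^{i-1}-1)(aq^{i-1}-1)q^{-i+n+2}\bigl(abcdq^{2n+2}-abc(q+1)q^{n+1}+d\bigr)}{\Delta_{2n+1}\Delta_{2n+3}};$$ $0$ otherwise. $B_{n,2}$: for $i=j$, $$q^{-i}\left(\frac{q[i]_q(aq^i-1)(dq^{n+1}-1)}{\Delta_{2n+3}}+\frac{q[i-1]_q(q-aq^i)(dq^n-1)}{\Delta_{2n+1}}+q\right);$$ for $i=j-1$, $$-\frac{acq^{i+1}(q^{-i+n+1}-1)(bq^{-i+n+1}-1)\bigl(abcq^{2(n+1)}-d(q+1)q^n+1\bigr)}{\Delta_{2n+1}\Delta_{2n+3}};$$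 $0$ otherwise. $C_{n,1}$: for $i=j$, $$-\frac{acq^{n+2}(dq^n-1)(q^{-i+n+1}-1)(bq^{-i+n+1}-1)(acq^{i+n}-1)(abcq^{n+1}-d)(abcq^{i+n}-1)}{N_n};$$ for $i=j+1$, $$-\frac{ac(q^{i-1}-1)(aq^{i-1}-1)(dq^n-1)q^{-i+2n+3}(abcq^{n+1}-d)\bigl(-b(q+1)q^{-i+n-1}(acq^{2i}+q^2)+ab(b+1)cq^{2n+1}+b+1\bigr)}{N_n};$$ for $i=j+2$, $$-\frac{abc(aq^i-q)(aq^i-q^2)(dq^n-1)q^{-2i+3n+2}(q;q)_{i-1}(abcq^{n+1}-d)}{(q;q)_{i-3}\,N_n};$$ $0$ otherwise. $C_{n,2}$: for $i=j$, $$-\frac{ac(q-1)(dq^n-1)q^{n-i}[n-i+1]_q(bq^{n+1}-q^i)(abcq^{n+1}-d)\bigl((a+1)q^{i+1}(abcq^{2n+1}+1)-abc(q+1)q^{2n+2}-a(q+1)q^{2i}\bigr)}{N_n};$$ for $i=j+1$, $$-\frac{a(q^{i-1}-1)q^{n+1}(aq^{i-1}-1)(dq^n-1)(bcq^{-i+2n+2}-1)(abcq^{n+1}-d)(abcq^{-i+2n+2}-1)}{N_n};$$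 for $i=j-1$, $$-\frac{a^2c^2q^{n+2}(dq^n-1)(q^i-bq^n)(q^i-bq^{n+1})(q;q)_{n-i+1}(abcq^{n+1}-d)}{(q;q)_{n-i-1}\,N_n};$$ $0$ otherwise. The denominators vanish only for $B_{0,j}$ when $abcq=1$ and for $C_{1,j}$ when $abcq^2=1$; these singularities are removable, and there the entries are the limits of the displayed expressions with $c$ replaced by $c'$ as $c'\to c$, $c'\ne c$. (3) Let $L_n=(L_{n,1}^T,L_{n,2}^T)^T$, $B_n=(B_{n,1}^T,B_{n,2}^T)^T$, $C_n=(C_{n,1}^T,C_{n,2}^T)^T$ and $D_n^\dagger=(L_n^TL_n)^{-1}L_n^T$. Then $D_n^\dagger L_n=I_{n+2}$, and $(\mathbb P_n)_{n\ge0}$ is the one and only family of polynomial vectors with $\mathbb P_0=1$ and $$\mathbb P_{n+1}=D_n^\dagger\left[\begin{pmatrix}x\\y\end{pmatrix}\otimes I_{n+1}-B_n\right]\mathbb P_n-D_n^\dagger C_n\mathbb P_{n-1},\qquad n\ge0,\quad \mathbb P_{-1}=0.$$ -/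

import Mathlib

open Filter Topology

noncomputable section

namespace BigQJacobi

/-! ### Partial `q`-difference operators and the equation -/

/-- The `q`-number `[z]_q = (q^z - 1) / (q - 1)`. -/
def qNum (q : ℝ) (z : ℤ) : ℝ := (q ^ z - 1) / (q - 1)

/-- The `q`-shifted factorial `(x; q)_k`. -/
def qPoch (x q : ℝ) (k : ℕ) : ℝ := ∏ j ∈ Finset.range k, (1 - x * q ^ j)

/-- `D_q^1`. As for the three operators below, only its values at `x ≠ 0`, `y ≠ 0` are used. -/
def Dq1 (q : ℝ) (f : ℝ → ℝ → ℝ) (x y : ℝ) : ℝ := (f (q * x) y - f x y) / ((q - 1) * x)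

/-- `D_q^2`. -/
def Dq2 (q : ℝ) (f : ℝ → ℝ → ℝ) (x y : ℝ) : ℝ := (f x (q * y) - f x y) / ((q - 1) * y)

/-- `D_{q^{-1}}^1`. -/
def Dqinv1 (q : ℝ) (f : ℝ → ℝ → ℝ) (x y : ℝ) : ℝ :=
  q * (f x y - f (x / q) y) / ((q - 1) * x)

/-- `D_{q^{-1}}^2`. -/
def Dqinv2 (q : ℝ) (f : ℝ → ℝ → ℝ) (x y : ℝ) : ℝ :=
  q * (f x y - f x (y / q)) / ((q - 1) * y)

def a11 (q a c d x : ℝ) : ℝ := √q * (d * q - x) * (a * c * q ^ 2 - x)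

def a22 (q a d y : ℝ) : ℝ := √q * (a * q - y) * (d * q - y)

def a12a (q a b c d x y : ℝ) : ℝ := a * c * q ^ 4 * (d - b * x) * (1 - y)

def a12d (q a d x y : ℝ) : ℝ := (d * q - x) * (a * q - y)

def b1 (q a b c d x : ℝ) : ℝ :=
  q * (q * (d - a * c * d * q ^ 2 + a * c * q * (1 + b * q * (-1 + x))) - x) / (-1 + q)

def b2 (q a b c d y : ℝ) : ℝ :=
  q * (d * q + a * q * (1 - d * q + b * c * q ^ 2 * (-1 + y)) - y) / (-1 + q)

/-- The spectral parameter `λ_n`. -/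
def lam (q a b c : ℝ) (n : ℤ) : ℝ :=
  q ^ (2 - n) * qNum q n * ((1 - a * b * c * q ^ (n + 2)) / (q - 1))

/-- The second-order partial `q`-difference operator of the bivariate big `q`-Jacobi equation. -/
def qOp (q a b c d : ℝ) (u : ℝ → ℝ → ℝ) (x y : ℝ) : ℝ :=
  a11 q a c d x * √q * Dq1 q (Dqinv1 q u) x y
    + a22 q a d y * √q * Dq2 q (Dqinv2 q u) x y
    + a12a q a b c d x y * Dq1 q (Dq2 q u) x y
    + a12d q a d x y * Dqinv1 q (Dqinv2 q u) x y
    + b1 q a b c d x * Dq1 q u x y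
    + b2 q a b c d y * Dq2 q u x y

/-! ### Polynomial vectors -/

/-- A family of polynomial vectors: the `k`-th entry of the `n`-th vector, `0 ≤ k ≤ n`, is the
polynomial `P^n_{n-k,k}`. The variables are `x = X 0` and `y = X 1`. -/
abbrev PolyVecFamily : Type := (n : ℕ) → Fin (n + 1) → MvPolynomial (Fin 2) ℝ

/-- The polynomial function of two real variables. -/
def evalXY (p : MvPolynomial (Fin 2) ℝ) (x y : ℝ) : ℝ := MvPolynomial.eval ![x, y] p

/-- `P^n_{n-k,k} = x^{n-k} y^k +` terms of total degree less than `n`. -/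
def IsMonicFamily (P : PolyVecFamily) : Prop :=
  ∀ (n : ℕ) (k : Fin (n + 1)),
    ∀ m ∈ (P n k - MvPolynomial.X 0 ^ (n - (k : ℕ)) * MvPolynomial.X 1 ^ (k : ℕ)).support,
      m 0 + m 1 < n

/-- All entries of the `n`-th vector solve the equation with `λ = λ_n`. -/
def IsSolutionFamily (q a b c d : ℝ) (P : PolyVecFamily) : Prop :=
  ∀ (n : ℕ) (k : Fin (n + 1)) (x y : ℝ), x ≠ 0 → y ≠ 0 →
    qOp q a b c d (evalXY (P n k)) x y + lam q a b c n * evalXY (P n k) x y = 0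

/-- The vector `P_{n-1}`, with `n` entries; it is the empty vector for `n = 0`. -/
def prevVec (P : PolyVecFamily) : (n : ℕ) → Fin n → MvPolynomial (Fin 2) ℝ
  | 0 => Fin.elim0
  | n + 1 => P n

/-- A real matrix acting on a vector of polynomials. -/
def act {ι κ : Type} [Fintype κ] (M : Matrix ι κ ℝ) (p : κ → MvPolynomial (Fin 2) ℝ) :
    ι → MvPolynomial (Fin 2) ℝ :=
  (M.map MvPolynomial.C).mulVec p

/-! ### Recurrence relations -/

/-- `x_v P_n = A P_{n+1} + B P_n + G P_{n-1}`, where `x_0 = x`, `x_1 = y`. -/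
def IsRecurrence (P : PolyVecFamily) (v : Fin 2) (n : ℕ)
    (A : Matrix (Fin (n + 1)) (Fin (n + 2)) ℝ) (B : Matrix (Fin (n + 1)) (Fin (n + 1)) ℝ)
    (G : Matrix (Fin (n + 1)) (Fin n) ℝ) : Prop :=
  (fun k => MvPolynomial.X v * P n k) = act A (P (n + 1)) + act B (P n) + act G (prevVec P n)

/-- The matrices `L_{n,1}` (`v = 0`) and `L_{n,2}` (`v = 1`), with
`x_v 𝐱^n = L_{n,v+1} 𝐱^{n+1}`. -/
def shiftL (v : Fin 2) (n : ℕ) : Matrix (Fin (n + 1)) (Fin (n + 2)) ℝ :=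
  Matrix.of fun k l => if (l : ℕ) = (k : ℕ) + (v : ℕ) then 1 else 0

/-- The joint matrix `(M_1ᵀ, M_2ᵀ)ᵀ`; its rows are indexed by the block and the row in it. -/
def joint {m l : ℕ} (M : Fin 2 → Matrix (Fin m) (Fin l) ℝ) : Matrix (Fin 2 × Fin m) (Fin l) ℝ :=
  Matrix.of fun r j => M r.1 r.2 j

/-- The generalized inverse `D_n^† = (L_nᵀ L_n)⁻¹ L_nᵀ` of the joint matrix `L_n`. -/
def Ddag (n : ℕ) : Matrix (Fin (n + 2)) (Fin 2 × Fin (n + 1)) ℝ :=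
  ((joint fun v => shiftL v n).transpose * joint fun v => shiftL v n)⁻¹
    * (joint fun v => shiftL v n).transpose

/-- The Kronecker product `(x, y)ᵀ ⊗ I_{n+1}`. -/
def xyKron (n : ℕ) : Matrix (Fin 2 × Fin (n + 1)) (Fin (n + 1)) (MvPolynomial (Fin 2) ℝ) :=
  (Matrix.kroneckerMap (· * ·)
    (Matrix.of fun (v : Fin 2) (_ : Unit) => (MvPolynomial.X v : MvPolynomial (Fin 2) ℝ))
    (1 : Matrix (Fin (n + 1)) (Fin (n + 1)) (MvPolynomial (Fin 2) ℝ))).submatrix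
      id (fun k => ((), k))

/-- `P_{n+1} = D_n^† [(x, y)ᵀ ⊗ I_{n+1} - B_n] P_n - D_n^† G_n P_{n-1}` for all `n ≥ 0`, with
`P_0 = 1` (and `P_{-1} = 0`). Here `B_n` and `G_n` are the joint matrices. -/
def IsComputedRecursively
    (B : Fin 2 → (n : ℕ) → Matrix (Fin (n + 1)) (Fin (n + 1)) ℝ)
    (G : Fin 2 → (n : ℕ) → Matrix (Fin (n + 1)) (Fin n) ℝ) (P : PolyVecFamily) : Prop :=
  P 0 = (fun _ => 1) ∧
  ∀ n : ℕ, P (n + 1) =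
    act (Ddag n) ((xyKron n - (joint fun v => B v n).map MvPolynomial.C).mulVec (P n))
      - act (Ddag n * joint fun v => G v n) (prevVec P n)

/-! ### The explicit entries; rows `i` and columns `j` are numbered from `1` -/

/-- The entries of `B_{n,1}`. -/
def entryB1 (q a b c d : ℝ) (n i j : ℤ) : ℝ :=
  if i = j then
    d * q ^ (-i + n + 2) * (a * c * q ^ (2 * i - 1) * (q ^ (-i + n + 1) *
          (b * (a * c * q ^ (i + n + 1) + q ^ (-i + n + 2) - q - 1) - q - 1) + 1) + 1)
        / ((a * b * c * q ^ (2 * n + 1) - 1) * (a * b * c * q ^ (2 * n + 3) - 1))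
      + a * c * q ^ (n + 2) * (-b * (q + 1) * q ^ (n - i) * (a * c * q ^ (2 * i) + q)
          + a * b * (b + 1) * c * q ^ (2 * n + 2) + b + 1)
        / ((a * b * c * q ^ (2 * n + 1) - 1) * (a * b * c * q ^ (2 * n + 3) - 1))
  else if i = j + 1 then
    -((q ^ (i - 1) - 1) * (a * q ^ (i - 1) - 1) * q ^ (-i + n + 2)
        * (a * b * c * d * q ^ (2 * n + 2) - a * b * c * (q + 1) * q ^ (n + 1) + d)
      / ((a * b * c * q ^ (2 * n + 1) - 1) * (a * b * c * q ^ (2 * n + 3) - 1)))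
  else 0

/-- The entries of `B_{n,2}`. -/
def entryB2 (q a b c d : ℝ) (n i j : ℤ) : ℝ :=
  if i = j then
    q ^ (-i) * (q * qNum q i * (a * q ^ i - 1) * (d * q ^ (n + 1) - 1)
          / (a * b * c * q ^ (2 * n + 3) - 1)
        + q * qNum q (i - 1) * (q - a * q ^ i) * (d * q ^ n - 1)
          / (a * b * c * q ^ (2 * n + 1) - 1)
        + q)
  else if i = j - 1 then
    -(a * c * q ^ (i + 1) * (q ^ (-i + n + 1) - 1) * (b * q ^ (-i + n + 1) - 1)
        * (a * b * c * q ^ (2 * (n + 1)) - d * (q + 1) * q ^ n + 1)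
      / ((a * b * c * q ^ (2 * n + 1) - 1) * (a * b * c * q ^ (2 * n + 3) - 1)))
  else 0

/-- The common denominator of the entries of `C_{n,1}` and `C_{n,2}`. -/
def denC (q a b c : ℝ) (n : ℤ) : ℝ :=
  (a * b * c * q ^ (2 * n) - 1) * (a * b * c * q ^ (2 * n + 1) - 1) ^ 2
    * (a * b * c * q ^ (2 * n + 2) - 1)

/-- The entries of `C_{n,1}`. -/
def entryC1 (q a b c d : ℝ) (n i j : ℤ) : ℝ :=
  if i = j then
    -(a * c * q ^ (n + 2) * (d * q ^ n - 1) * (q ^ (-i + n + 1) - 1) * (b * q ^ (-i + n + 1) - 1)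
        / denC q a b c n)
      * ((a * c * q ^ (i + n) - 1) * (a * b * c * q ^ (n + 1) - d)
        * (a * b * c * q ^ (i + n) - 1))
  else if i = j + 1 then
    -(a * c * (q ^ (i - 1) - 1) * (a * q ^ (i - 1) - 1) * (d * q ^ n - 1) * q ^ (-i + 2 * n + 3)
        * (a * b * c * q ^ (n + 1) - d) / denC q a b c n)
      * (-b * (q + 1) * q ^ (-i + n - 1) * (a * c * q ^ (2 * i) + q ^ 2)
        + a * b * (b + 1) * c * q ^ (2 * n + 1) + b + 1)
  else if i = j + 2 then
    -(a * b * c * (a * q ^ i - q) * (a * q ^ i - q ^ 2) * (d * q ^ n - 1)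
        * q ^ (-2 * i + 3 * n + 2) * qPoch q q (i - 1).toNat * (a * b * c * q ^ (n + 1) - d)
      / (qPoch q q (i - 3).toNat * denC q a b c n))
  else 0

/-- The entries of `C_{n,2}`. -/
def entryC2 (q a b c d : ℝ) (n i j : ℤ) : ℝ :=
  if i = j then
    -(a * c * (q - 1) * (d * q ^ n - 1) * q ^ (n - i) * qNum q (-i + n + 1)
        * (b * q ^ (n + 1) - q ^ i) * (a * b * c * q ^ (n + 1) - d) / denC q a b c n)
      * ((a + 1) * q ^ (i + 1) * (a * b * c * q ^ (2 * n + 1) + 1)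
        - a * b * c * (q + 1) * q ^ (2 * n + 2) - a * (q + 1) * q ^ (2 * i))
  else if i = j + 1 then
    -(a * (q ^ (i - 1) - 1) * q ^ (n + 1) * (a * q ^ (i - 1) - 1) * (d * q ^ n - 1)
        * (b * c * q ^ (-i + 2 * n + 2) - 1) / denC q a b c n)
      * ((a * b * c * q ^ (n + 1) - d) * (a * b * c * q ^ (-i + 2 * n + 2) - 1))
  else if i = j - 1 then
    -(a ^ 2 * c ^ 2 * q ^ (n + 2) * (d * q ^ n - 1) * (q ^ i - b * q ^ n)
        * (q ^ i - b * q ^ (n + 1)) * qPoch q q (n - i + 1).toNat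
        * (a * b * c * q ^ (n + 1) - d)
      / (qPoch q q (n - i - 1).toNat * denC q a b c n))
  else 0

/-- The entries of `B_{n,v+1}`. -/
def entryB (q a b c d : ℝ) (v : Fin 2) (n i j : ℤ) : ℝ :=
  if v = 0 then entryB1 q a b c d n i j else entryB2 q a b c d n i j

/-- The entries of `C_{n,v+1}`. -/
def entryC (q a b c d : ℝ) (v : Fin 2) (n i j : ℤ) : ℝ :=
  if v = 0 then entryC1 q a b c d n i j else entryC2 q a b c d n i j

end BigQJacobi

end

/-! Up to the factor `q ^ 2 / (q - 1) ^ 2` and an additive constant, the left side of the equation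
without its `λ` term is an operator `M` (`mOp`), and `(E_n)` says that `u` is an eigenfunction of
`M` for `μ_n = s q ^ n + q ^ (-n)`, `s = a b c q ^ 2`. On polynomials, `M` never raises the total
degree and multiplies the part of top degree `n` by `μ_n`. Moreover `μ_i - μ_j` with `i ≠ j`
vanishes only if `a b c q ^ (i + j + 2) = 1`, which is impossible as `i + j + 2 ≥ 3`. So every
monomial is the leading term of exactly one monic eigenvector, and its coefficients one and two
degrees below the top follow from the eigenvalue equation.

The reason for a three-term recurrence is algebraic. `M` is quadratic in two commuting pairs of
`q`-oscillators, one acting on `x` and one on `y`. The commutator `Z` of `M` with either coordinate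
therefore satisfies a cubic relation (`cubic_relation`, `mOp_cubic`): `M²Z - (q + q⁻¹) MZM + ZM² + s
(q - q⁻¹)² Z = 0`. Applied to an eigenfunction for `μ_n`, it says that `(M - μ_(n-1)) (M - μ_(n+1))
(M - μ_n)` kills the coordinate times this eigenfunction (`mulVar_eigenfunction`). No inner product
or orthogonality is needed.

The matrix entries are found by matching the coefficients of degrees `n + 1`, `n` and `n - 1`. The
remainder has degree below `n - 1` and is killed by the triple product, which is injective in these
degrees, so it vanishes (`IsEigenFamily.recurrence`). The displayed formulas are then identities of
rational functions in `q ^ m` and `q ^ k`, and the exceptional entries follow by continuity in `c`.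
The matrices are unique because the leading monomials are independent, and the recursive formula is
the stacked recurrence multiplied by a left inverse of `L_n`. -/

noncomputable section

namespace BigQJacobi

set_option linter.unusedSimpArgs false
set_option linter.unusedVariables false

/-! ### The cubic relation in an abstract `q`-oscillator algebra -/

section CubicRelation

variable {R : Type*} [Ring R] [Algebra ℝ R]

/-- The relations reorder every word into a normal form, with `y` before `A` before `B` before `P`
before `Q`, and both sides are compared there. Here `z` is the commutator of `M` and `y` divided by
`q - 1`, and `V` is a name for the `q`-commutator of `M` and `z`. The content is that a
`q⁻¹`-commutator with `M` leads from `V` back to `z`. The free parameter `σ` lets the same algebra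
serve both coordinates. -/
theorem commutator_relations {q κ τ η φ θ σ : ℝ} (hq : q ≠ 0) (hσ : σ ≠ 0) {A B y P Q : R}
    (hBA : B * A = q • (A * B) + (κ * (1 - q)) • 1) (hQP : Q * P = q • (P * Q) + (τ * (1 - q)) • 1)
    (hAy : A * y = q • (y * A) + (η * (1 - q)) • 1)
    (hBy : B * y = q⁻¹ • (y * B) - (φ * (1 - q)) • 1)
    (hyAB : y * (A * B) = κ • y + φ • A + η • B - θ • 1)
    (hPA : P * A = A * P) (hPB : P * B = B * P) (hPy : P * y = y * P)
    (hQA : Q * A = A * Q) (hQB : Q * B = B * Q) (hQy : Q * y = y * Q)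
    {M z V : R}
    (hM : M = A * P + B * Q + σ • (A * B - κ • 1) + (q / σ) • (P * Q - τ • 1))
    (hz : z = (y * A - η • 1) * P - q⁻¹ • ((y * B - (q * φ) • 1) * Q)
      + (σ * φ) • A - (σ * q⁻¹ * η) • B)
    (hV : V = (σ * η) • ((A * B - κ • 1) * P) + (σ * (1 + q⁻¹) * η) • (B * B * Q)
      - (σ * θ) • (B * Q) + q⁻¹ • ((y * B - (q * φ) • 1) * B * (Q * Q))
      + τ • (η • B - κ • y) + ((q + 1) * η) • (B * (P * Q - τ • 1)) - (q * θ) • (P * Q - τ • 1)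
      + (q / σ) • ((y * B - (q * φ) • 1) * ((P * Q - τ • 1) * Q))
      + (σ ^ 2 * η) • ((A * B - κ • 1) * B)) :
    M * z - q • (z * M) = (q - q⁻¹) • V ∧
      M * V - q⁻¹ • (V * M) = -(τ * κ * (q - q⁻¹)) • z := by
  have hBA' (w : R) : B * (A * w) = q • (A * (B * w)) + (κ * (1 - q)) • w := by
    rw [← mul_assoc, hBA]; simp [add_mul, mul_assoc]
  have hQP' (w : R) : Q * (P * w) = q • (P * (Q * w)) + (τ * (1 - q)) • w := by
    rw [← mul_assoc, hQP]; simp [add_mul, mul_assoc]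
  have hAy' (w : R) : A * (y * w) = q • (y * (A * w)) + (η * (1 - q)) • w := by
    rw [← mul_assoc, hAy]; simp [add_mul, mul_assoc]
  have hBy' (w : R) : B * (y * w) = q⁻¹ • (y * (B * w)) - (φ * (1 - q)) • w := by
    rw [← mul_assoc, hBy]; simp [sub_mul, mul_assoc]
  have hyAB' (w : R) : y * (A * (B * w)) = κ • (y * w) + φ • (A * w) + η • (B * w) - θ • w := by
    rw [← mul_assoc A, ← mul_assoc y, hyAB]; simp [sub_mul, add_mul]
  -- The rule for `y * (A * B)` does not apply to `y * (A * (A * B))`. Moving `B` one place to the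
  -- left first gives the missing rewriting rule.
  have hyAAB : y * (A * (A * B)) =
      κ • (y * A) + (q⁻¹ * φ) • (A * A) + (η * q⁻¹) • (B * A) - (q⁻¹ * θ) • A := by
    have h : A * (A * B) = q⁻¹ • (A * (B * A)) - (q⁻¹ * (κ * (1 - q))) • A := by
      rw [hBA, mul_add, mul_smul_comm, mul_smul_comm, mul_one]
      match_scalars <;> field_simp <;> ring
    rw [h, mul_sub, mul_smul_comm, hyAB', mul_smul_comm]
    match_scalars <;> field_simp <;> ring
  have hyAAB' (w : R) : y * (A * (A * (B * w))) = κ • (y * (A * w)) + (q⁻¹ * φ) • (A * (A * w))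
      + (η * q⁻¹) • (B * (A * w)) - (q⁻¹ * θ) • (A * w) := by
    rw [← mul_assoc A B, ← mul_assoc A (A * B), ← mul_assoc y, hyAAB]
    simp [sub_mul, add_mul, mul_assoc]
  have hPA' (w : R) : P * (A * w) = A * (P * w) := by rw [← mul_assoc, hPA, mul_assoc]
  have hPB' (w : R) : P * (B * w) = B * (P * w) := by rw [← mul_assoc, hPB, mul_assoc]
  have hPy' (w : R) : P * (y * w) = y * (P * w) := by rw [← mul_assoc, hPy, mul_assoc]
  have hQA' (w : R) : Q * (A * w) = A * (Q * w) := by rw [← mul_assoc, hQA, mul_assoc]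
  have hQB' (w : R) : Q * (B * w) = B * (Q * w) := by rw [← mul_assoc, hQB, mul_assoc]
  have hQy' (w : R) : Q * (y * w) = y * (Q * w) := by rw [← mul_assoc, hQy, mul_assoc]
  subst hM hz hV
  constructor
  · simp only [mul_add, add_mul, mul_sub, sub_mul, smul_mul_assoc, mul_smul_comm, mul_assoc,
      hBA, hQP, hAy, hBy, hyAB, hPA, hPB, hPy, hQA, hQB, hQy, hBA', hQP', hAy', hBy', hyAB', hyAAB,
      hyAAB', hPA',
      hPB', hPy', hQA', hQB', hQy', mul_one, one_mul]
    match_scalars <;> field_simp <;> ring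
  · simp only [mul_add, add_mul, mul_sub, sub_mul, smul_mul_assoc, mul_smul_comm, mul_assoc,
      hBA, hQP, hAy, hBy, hyAB, hPA, hPB, hPy, hQA, hQB, hQy, hBA', hQP', hAy', hBy', hyAB', hyAAB,
      hyAAB', hPA',
      hPB', hPy', hQA', hQB', hQy', mul_one, one_mul]
    match_scalars <;> field_simp <;> ring

/-- The two relations of `commutator_relations` compose: the maps `w ↦ M w - q w M` and `w ↦ M w -
q⁻¹ w M`, applied in turn, multiply `z` by `-τ κ (q - q⁻¹)²`. Expanding the composition gives the
cubic expression, and `Z` is a multiple of `z`. -/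
theorem cubic_relation {q κ τ η φ θ σ : ℝ} (hq : q ≠ 0) (hσ : σ ≠ 0) {A B y P Q : R}
    (hBA : B * A = q • (A * B) + (κ * (1 - q)) • 1) (hQP : Q * P = q • (P * Q) + (τ * (1 - q)) • 1)
    (hAy : A * y = q • (y * A) + (η * (1 - q)) • 1)
    (hBy : B * y = q⁻¹ • (y * B) - (φ * (1 - q)) • 1)
    (hyAB : y * (A * B) = κ • y + φ • A + η • B - θ • 1)
    (hPA : P * A = A * P) (hPB : P * B = B * P) (hPy : P * y = y * P)
    (hQA : Q * A = A * Q) (hQB : Q * B = B * Q) (hQy : Q * y = y * Q)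
    {M Z : R} (hM : M = A * P + B * Q + σ • (A * B - κ • 1) + (q / σ) • (P * Q - τ • 1))
    (hZ : Z = M * y - y * M) :
    M * (M * Z) - (q + q⁻¹) • (M * (Z * M)) + Z * (M * M) + (τ * κ * (q - q⁻¹) ^ 2) • Z = 0 := by
  obtain ⟨h₁, h₂⟩ := commutator_relations hq hσ hBA hQP hAy hBy hyAB hPA hPB hPy hQA hQB hQy hM rfl rfl
  set z := (y * A - η • 1) * P - q⁻¹ • ((y * B - (q * φ) • 1) * Q)
      + (σ * φ) • A - (σ * q⁻¹ * η) • B with hz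
  -- Only the two relations between `z` and `V` matter from here on.
  generalize (_ : R) = V at h₁ h₂
  have hZz : Z = (q - 1) • z := by
    have hAy' (w : R) : A * (y * w) = q • (y * (A * w)) + (η * (1 - q)) • w := by
      rw [← mul_assoc, hAy]; simp [add_mul, mul_assoc]
    simp only [hZ, hM, hz, mul_add, add_mul, mul_sub, sub_mul, smul_mul_assoc, mul_smul_comm,
      mul_assoc, hPy, hQy, hAy', hAy, hBy, mul_one, one_mul]
    simp only [← mul_assoc, hAy, hBy, hPy, hQy]
    simp only [mul_add, add_mul, mul_sub, sub_mul, smul_mul_assoc, mul_smul_comm,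
      mul_assoc, hPy, hQy, mul_one, one_mul]
    match_scalars <;> field_simp <;> ring
  have h₃ : M * (M * z - q • (z * M)) - q⁻¹ • ((M * z - q • (z * M)) * M)
      = -(τ * κ * (q - q⁻¹) ^ 2) • z := by
    rw [h₁, mul_smul_comm, smul_mul_assoc, smul_comm q⁻¹, ← smul_sub, h₂, smul_smul]
    congr 1; ring
  have h₄ : M * (M * z) - (q + q⁻¹) • (M * (z * M)) + z * (M * M)
      = -(τ * κ * (q - q⁻¹) ^ 2) • z := by
    rw [← h₃]
    simp only [mul_sub, sub_mul, smul_mul_assoc, mul_smul_comm, mul_assoc]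
    match_scalars <;> field_simp <;> ring
  rw [hZz]
  simp only [smul_mul_assoc, mul_smul_comm]
  have h₅ := congrArg (fun w => (q - 1) • w) h₄
  rw [← sub_eq_zero] at h₅
  rw [← h₅]
  module

end CubicRelation

/-! ### Functions of two nonzero real variables -/

/-- Real functions of two nonzero real variables. -/
abbrev UFun : Type := ℝˣ → ℝˣ → ℝ

/-- The operator `f ↦ (α - β / x) f(tx, y) + (β / x) f(x, y)`. -/
def shiftX (t : ℝˣ) (α β : ℝ) : Module.End ℝ UFun where
  toFun f x y := (α - β / x) * f (t * x) y + β / x * f x y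
  map_add' f g := by ext x y; simp; ring
  map_smul' r f := by ext x y; simp; ring

/-- The operator `f ↦ (α - β / y) f(x, ty) + (β / y) f(x, y)`. -/
def shiftY (t : ℝˣ) (α β : ℝ) : Module.End ℝ UFun where
  toFun f x y := (α - β / y) * f x (t * y) + β / y * f x y
  map_add' f g := by ext x y; simp; ring
  map_smul' r f := by ext x y; simp; ring

/-- Multiplication by a coordinate. -/
def mulVar (v : Fin 2) : Module.End ℝ UFun where
  toFun f x y := (if v = 0 then (x : ℝ) else y) * f x y
  map_add' f g := by ext x y; simp only [Pi.add_apply]; ring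
  map_smul' r f := by ext x y; simp only [Pi.smul_apply, smul_eq_mul, RingHom.id_apply]; ring

theorem shiftX_apply (t : ℝˣ) (α β : ℝ) (f : UFun) (x y : ℝˣ) :
    shiftX t α β f x y = (α - β / x) * f (t * x) y + β / x * f x y := rfl

theorem shiftY_apply (t : ℝˣ) (α β : ℝ) (f : UFun) (x y : ℝˣ) :
    shiftY t α β f x y = (α - β / y) * f x (t * y) + β / y * f x y := rfl

theorem mulVar_apply (v : Fin 2) (f : UFun) (x y : ℝˣ) :
    mulVar v f x y = (if v = 0 then (x : ℝ) else y) * f x y := rfl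

theorem shiftX_mul_shiftY (t s : ℝˣ) (α β γ δ : ℝ) :
    shiftX t α β * shiftY s γ δ = shiftY s γ δ * shiftX t α β := by
  ext f x y
  simp only [Module.End.mul_apply, shiftX_apply, shiftY_apply]
  ring

theorem shiftX_mul_mulVar_one (t : ℝˣ) (α β : ℝ) :
    shiftX t α β * mulVar 1 = mulVar 1 * shiftX t α β := by
  ext f x y
  simp only [Module.End.mul_apply, shiftX_apply, mulVar_apply, one_ne_zero, if_false]
  ring

theorem shiftY_mul_mulVar_zero (t : ℝˣ) (α β : ℝ) :
    shiftY t α β * mulVar 0 = mulVar 0 * shiftY t α β := by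
  ext f x y
  simp only [Module.End.mul_apply, shiftY_apply, mulVar_apply, if_true]
  ring

/-! ### The second-order operator and its cubic relation -/

section Operator

variable (u : ℝˣ) (a b c d : ℝ)

/-- The second-order operator, normalized to have eigenvalues `s q^n + q^(-n)`,
`s = a b c q^2`, as a quadratic expression in `q`-oscillators. -/
def mOp : Module.End ℝ UFun :=
  (a * c * u ^ 2 : ℝ) • (shiftX u b d * shiftY u 1 1) + shiftX u⁻¹ 1 (d * u) * shiftY u⁻¹ 1 (a * u)
    - (d * u : ℝ) • (shiftY u 1 1 * shiftY u⁻¹ 1 (a * u) - 1)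
    - (a * c * u ^ 2 / d : ℝ) • (shiftX u b d * shiftX u⁻¹ 1 (d * u) - b • 1)

variable {d}

/-- These are the hypotheses of `cubic_relation` on `A`, `B` and `y`, with `κ = α`, `η = β`, `φ = γ`
and `θ = β + α γ`. -/
theorem oscillatorX (α β γ : ℝ) :
    shiftX u⁻¹ 1 (γ * u) * shiftX u α β
        = (u : ℝ) • (shiftX u α β * shiftX u⁻¹ 1 (γ * u)) + (α * (1 - u)) • 1 ∧
    shiftX u α β * mulVar 0 = (u : ℝ) • (mulVar 0 * shiftX u α β) + (β * (1 - u)) • 1 ∧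
    shiftX u⁻¹ 1 (γ * u) * mulVar 0
        = (u : ℝ)⁻¹ • (mulVar 0 * shiftX u⁻¹ 1 (γ * u)) - (γ * (1 - u)) • 1 ∧
    mulVar 0 * (shiftX u α β * shiftX u⁻¹ 1 (γ * u)) = α • mulVar 0
      + γ • shiftX u α β + β • shiftX u⁻¹ 1 (γ * u) - (β + α * γ) • 1 := by
  have hu := u.ne_zero
  refine ⟨?_, ?_, ?_, ?_⟩ <;> ext f x y <;> have hx := x.ne_zero <;>
    simp only [Module.End.mul_apply, LinearMap.add_apply, LinearMap.sub_apply,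
      LinearMap.smul_apply, Pi.add_apply, Pi.sub_apply, Pi.smul_apply, shiftX_apply, mulVar_apply,
      Module.End.one_apply, smul_eq_mul, if_true, Units.val_mul, inv_mul_cancel_left,
      mul_inv_cancel_left, Units.val_inv_eq_inv_val] <;> field_simp <;> ring

theorem oscillatorY (α β γ : ℝ) :
    shiftY u⁻¹ 1 (γ * u) * shiftY u α β
        = (u : ℝ) • (shiftY u α β * shiftY u⁻¹ 1 (γ * u)) + (α * (1 - u)) • 1 ∧
    shiftY u α β * mulVar 1 = (u : ℝ) • (mulVar 1 * shiftY u α β) + (β * (1 - u)) • 1 ∧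
    shiftY u⁻¹ 1 (γ * u) * mulVar 1
        = (u : ℝ)⁻¹ • (mulVar 1 * shiftY u⁻¹ 1 (γ * u)) - (γ * (1 - u)) • 1 ∧
    mulVar 1 * (shiftY u α β * shiftY u⁻¹ 1 (γ * u)) = α • mulVar 1
      + γ • shiftY u α β + β • shiftY u⁻¹ 1 (γ * u) - (β + α * γ) • 1 := by
  have hu := u.ne_zero
  refine ⟨?_, ?_, ?_, ?_⟩ <;> ext f x y <;> have hy := y.ne_zero <;>
    simp only [Module.End.mul_apply, LinearMap.add_apply, LinearMap.sub_apply,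
      LinearMap.smul_apply, Pi.add_apply, Pi.sub_apply, Pi.smul_apply, shiftY_apply, mulVar_apply,
      Module.End.one_apply, smul_eq_mul, one_ne_zero, if_false, Units.val_mul, inv_mul_cancel_left,
      mul_inv_cancel_left, Units.val_inv_eq_inv_val] <;> field_simp <;> ring

/-- For `x`, the oscillators in `x` play the role of `A`, `B` and those in `y` the role of `P`, `Q`;
for `y` the roles are exchanged. In both cases `τ κ = a b c u ^ 2`. -/
theorem mOp_cubic (hd : d ≠ 0) (ha : a ≠ 0) (hc : c ≠ 0) (v : Fin 2) :
    let M := mOp u a b c d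
    let Z := M * mulVar v - mulVar v * M
    M * (M * Z) - ((u : ℝ) + (u : ℝ)⁻¹) • (M * (Z * M)) + Z * (M * M)
      + (a * b * c * u ^ 2 * ((u : ℝ) - (u : ℝ)⁻¹) ^ 2) • Z = 0 := by
  have hu := u.ne_zero
  obtain ⟨hx₁, hx₂, hx₃, hx₄⟩ := oscillatorX u b d d
  obtain ⟨hy₁, hy₂, hy₃, hy₄⟩ := oscillatorY u 1 1 a
  intro M Z
  have hM : M = (a * c * u ^ 2 : ℝ) • (shiftX u b d * shiftY u 1 1)
    + shiftX u⁻¹ 1 (d * u) * shiftY u⁻¹ 1 (a * u)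
    - (d * u : ℝ) • (shiftY u 1 1 * shiftY u⁻¹ 1 (a * u) - 1)
    - (a * c * u ^ 2 / d : ℝ) • (shiftX u b d * shiftX u⁻¹ 1 (d * u) - b • 1) := rfl
  fin_cases v
  -- The factor `a c u ^ 2` is absorbed into `P`. The value of `σ` is read off from the term in `A *
  -- B`, and then `q / σ` gives the right coefficient `-d u` of the other pair.
  · have h := cubic_relation (R := Module.End ℝ UFun) (q := u) (κ := b) (τ := a * c * u ^ 2)
      (η := d) (φ := d) (θ := d + b * d) (σ := -(a * c * u ^ 2 / d)) (A := shiftX u b d)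
      (B := shiftX u⁻¹ 1 (d * u)) (P := (a * c * u ^ 2 : ℝ) • shiftY u 1 1)
      (Q := shiftY u⁻¹ 1 (a * u)) (y := mulVar 0) (M := M) (Z := Z) hu
      (by simp [hd, ha, hc]) hx₁ ?_ hx₂ hx₃ hx₄
      (by rw [smul_mul_assoc, mul_smul_comm, shiftX_mul_shiftY])
      (by rw [smul_mul_assoc, mul_smul_comm, shiftX_mul_shiftY])
      (by rw [smul_mul_assoc, mul_smul_comm, shiftY_mul_mulVar_zero])
      (shiftX_mul_shiftY ..).symm (shiftX_mul_shiftY ..).symm (shiftY_mul_mulVar_zero ..) ?_ rfl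
    · rw [← h]; congr 2; ring
    · rw [mul_smul_comm, hy₁, smul_mul_assoc]; module
    · rw [hM, smul_mul_assoc, mul_smul_comm]
      match_scalars <;> field_simp <;> ring
  · have h := cubic_relation (R := Module.End ℝ UFun) (q := u) (κ := 1) (τ := a * c * u ^ 2 * b)
      (η := 1) (φ := a) (θ := 1 + 1 * a) (σ := -(d * u)) (A := shiftY u 1 1)
      (B := shiftY u⁻¹ 1 (a * u)) (P := (a * c * u ^ 2 : ℝ) • shiftX u b d)
      (Q := shiftX u⁻¹ 1 (d * u)) (y := mulVar 1) (M := M) (Z := Z) hu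
      (by simp [hd]) hy₁ ?_ hy₂ hy₃ hy₄
      (by rw [smul_mul_assoc, mul_smul_comm, shiftX_mul_shiftY])
      (by rw [smul_mul_assoc, mul_smul_comm, shiftX_mul_shiftY])
      (by rw [smul_mul_assoc, mul_smul_comm, shiftX_mul_mulVar_one])
      (shiftX_mul_shiftY ..) (shiftX_mul_shiftY ..) (shiftX_mul_mulVar_one ..) ?_ rfl
    · rw [← h]; congr 2; ring
    · rw [mul_smul_comm, hx₁, smul_mul_assoc]; module
    · rw [hM, smul_mul_assoc, mul_smul_comm, shiftX_mul_shiftY, shiftX_mul_shiftY]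
      match_scalars <;> field_simp <;> ring

/-- The normalized eigenvalue `s q^n + q^(-n)` with `s = a b c q^2`, at `t = q^n`. -/
def mEig (q a b c t : ℝ) : ℝ := a * b * c * q ^ 2 * t + t⁻¹

/-- A coordinate times an eigenfunction for `q^n` is a sum of eigenfunctions for
`q^(n+1)`, `q^n` and `q^(n-1)`. -/
theorem mulVar_eigenfunction (hd : d ≠ 0) (ha : a ≠ 0) (hc : c ≠ 0) (v : Fin 2) {t : ℝ}
    (ht : t ≠ 0) {f : UFun} (hf : mOp u a b c d f = mEig u a b c t • f) :
    let S (r : ℝ) : Module.End ℝ UFun := mOp u a b c d - mEig u a b c r • 1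
    S (t / u) (S (t * u) (S t (mulVar v f))) = 0 := by
  intro S
  have hu := u.ne_zero
  -- Write `μ(t)` for the eigenvalue and `s = a b c u ^ 2`. On `f` the relation becomes `(M² - (u +
  -- u⁻¹) μ(t) M + μ(t)² + s (u - u⁻¹)²) (M - μ(t))` applied to the coordinate times `f`. The
  -- quadratic factor has the roots `μ(t u)` and `μ(t / u)`: their sum is `(u + u⁻¹) μ(t)` and their
  -- product is `μ(t)² + s (u - u⁻¹)²`.
  have h := LinearMap.congr_fun (mOp_cubic u a b c hd ha hc v) f
  simp only [LinearMap.add_apply, LinearMap.sub_apply, LinearMap.smul_apply, Module.End.mul_apply,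
    LinearMap.zero_apply, hf, map_smul, map_sub] at h
  simp only [S, LinearMap.sub_apply, LinearMap.smul_apply, Module.End.one_apply, map_sub, map_smul]
  rw [← h]
  simp only [mEig]
  match_scalars <;> field_simp <;> ring

/-- The restriction of a function of two real variables. -/
def restr (f : ℝ → ℝ → ℝ) : UFun := fun x y => f x y

/-- Both sides are combinations of the same seven values of `f`, since no shift by `q` in one
variable is combined with a shift by `q⁻¹` in the other. The coefficients agree one by one. The
constant `1 + a b c u ^ 2` is the eigenvalue of `mOp` on constants. -/
theorem qOp_eq_mOp (hd : d ≠ 0) (hu : 0 < (u : ℝ)) (hu1 : (u : ℝ) ≠ 1) (f : ℝ → ℝ → ℝ) (x y : ℝˣ) :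
    (u - 1 : ℝ) ^ 2 * qOp u a b c d f x y
      = u ^ 2 * (mOp u a b c d (restr f) x y - (1 + a * b * c * u ^ 2) * f x y) := by
  have hx := x.ne_zero
  have hy := y.ne_zero
  have hu0 := hu.ne'
  have hu1' : (u - 1 : ℝ) ≠ 0 := sub_ne_zero.2 hu1
  have e₀ : (-1 + u : ℝ) = u - 1 := by ring
  have hs : √(u : ℝ) * √(u : ℝ) = u := Real.mul_self_sqrt hu.le
  have e₁ : (u : ℝ) * (x / u) = x := by field_simp
  have e₂ : (u : ℝ) * (y / u) = y := by field_simp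
  have e₃ : (u : ℝ) * x / u = x := by field_simp
  have e₄ : (u : ℝ) * y / u = y := by field_simp
  simp only [mOp, Module.End.mul_apply, LinearMap.add_apply, LinearMap.sub_apply,
      LinearMap.smul_apply, Pi.add_apply, Pi.sub_apply, Pi.smul_apply, shiftX_apply, shiftY_apply,
      Module.End.one_apply, smul_eq_mul, restr, Units.val_mul, inv_mul_cancel_left,
      mul_inv_cancel_left, Units.val_inv_eq_inv_val, qOp, Dq1, Dq2, Dqinv1, Dqinv2, a11, a22,
      a12a, a12d, b1, b2, e₀, e₁, e₂, e₃, e₄, ← div_eq_inv_mul,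
      Units.val_div_eq_div_val]
  have h₁ : (√(u : ℝ) * (d * u - x) * (a * c * u ^ 2 - x) * √(u : ℝ))
    = u * ((d * u - x) * (a * c * u ^ 2 - x)) := by linear_combination (d * u - x) * (a * c * u ^ 2 - x) * hs
  have h₂ : (√(u : ℝ) * (a * u - y) * (d * u - y) * √(u : ℝ))
    = u * ((a * u - y) * (d * u - y)) := by linear_combination (a * u - y) * (d * u - y) * hs
  rw [h₁, h₂]
  generalize f (u * x) (u * y) = f₁
  generalize f (u * x) y = f₂
  generalize f x (u * y) = f₃
  generalize f (x / u) (y / u) = f₄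
  generalize f (x / u) y = f₅
  generalize f x (y / u) = f₆
  generalize f x y = f₀
  field_simp
  ring

end Operator

/-! ### The operator on polynomials -/

/-- The exponent of `x^m y^k`. -/
def expo (m k : ℕ) : Fin 2 →₀ ℕ := Finsupp.single 0 m + Finsupp.single 1 k

theorem expo_zero (m k : ℕ) : expo m k 0 = m := by simp [expo]

theorem expo_one (m k : ℕ) : expo m k 1 = k := by simp [expo]

theorem eq_expo (e : Fin 2 →₀ ℕ) : e = expo (e 0) (e 1) := by
  ext i
  fin_cases i
  · exact (expo_zero _ _).symm
  · exact (expo_one _ _).symm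

theorem expo_inj {m k m' k' : ℕ} : expo m k = expo m' k' ↔ m = m' ∧ k = k' := by
  refine ⟨fun h => ⟨?_, ?_⟩, fun ⟨h₁, h₂⟩ => by rw [h₁, h₂]⟩
  · simpa only [expo_zero] using congrArg (fun e => e 0) h
  · simpa only [expo_one] using congrArg (fun e => e 1) h

/-- The coefficient of `x^m y^k`. -/
def cf (p : MvPolynomial (Fin 2) ℝ) (m k : ℕ) : ℝ := p.coeff (expo m k)

/-- The monomial `x^m y^k`. -/
def mono (m k : ℕ) : MvPolynomial (Fin 2) ℝ := MvPolynomial.monomial (expo m k) 1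

theorem mono_eq (m k : ℕ) : mono m k = MvPolynomial.X 0 ^ m * MvPolynomial.X 1 ^ k := by
  rw [mono, expo, MvPolynomial.X_pow_eq_monomial, MvPolynomial.X_pow_eq_monomial,
    MvPolynomial.monomial_mul, one_mul]

theorem cf_mono (m k m' k' : ℕ) : cf (mono m k) m' k' = if m' = m ∧ k' = k then 1 else 0 := by
  rw [cf, mono, MvPolynomial.coeff_monomial]
  simp only [expo_inj, eq_comm]

theorem cf_add (p r : MvPolynomial (Fin 2) ℝ) (m k : ℕ) : cf (p + r) m k = cf p m k + cf r m k :=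
  MvPolynomial.coeff_add ..

theorem cf_sub (p r : MvPolynomial (Fin 2) ℝ) (m k : ℕ) : cf (p - r) m k = cf p m k - cf r m k :=
  MvPolynomial.coeff_sub ..

theorem cf_smul (t : ℝ) (p : MvPolynomial (Fin 2) ℝ) (m k : ℕ) : cf (t • p) m k = t * cf p m k :=
  MvPolynomial.coeff_smul ..

theorem cf_zero (m k : ℕ) : cf 0 m k = 0 := MvPolynomial.coeff_zero _

theorem cf_sum {ι : Type*} (s : Finset ι) (p : ι → MvPolynomial (Fin 2) ℝ) (m k : ℕ) :
    cf (∑ i ∈ s, p i) m k = ∑ i ∈ s, cf (p i) m k := MvPolynomial.coeff_sum ..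

theorem cf_ext {p r : MvPolynomial (Fin 2) ℝ} (h : ∀ m k, cf p m k = cf r m k) : p = r := by
  ext e
  rw [eq_expo e]
  exact h _ _

theorem cf_X_zero_mul (p : MvPolynomial (Fin 2) ℝ) (m k : ℕ) :
    cf (MvPolynomial.X 0 * p) m k = if m = 0 then 0 else cf p (m - 1) k := by
  classical
  rw [cf, MvPolynomial.coeff_X_mul']
  rcases m with _ | m
  · simp [expo]
  · rw [if_pos (by simp [expo]), if_neg m.succ_ne_zero, cf]
    congr 1
    ext i
    fin_cases i <;> simp [expo]

theorem cf_X_one_mul (p : MvPolynomial (Fin 2) ℝ) (m k : ℕ) :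
    cf (MvPolynomial.X 1 * p) m k = if k = 0 then 0 else cf p m (k - 1) := by
  classical
  rw [cf, MvPolynomial.coeff_X_mul']
  rcases k with _ | k
  · simp [expo]
  · rw [if_pos (by simp [expo]), if_neg k.succ_ne_zero, cf]
    congr 1
    ext i
    fin_cases i <;> simp [expo]

/-- Induction on polynomials in two variables for linear statements. -/
theorem induction_mono {C : MvPolynomial (Fin 2) ℝ → Prop} (hadd : ∀ p r, C p → C r → C (p + r))
    (hmono : ∀ (t : ℝ) (m k : ℕ), C (t • mono m k)) (p : MvPolynomial (Fin 2) ℝ) : C p := by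
  induction p using MvPolynomial.induction_on' with
  | monomial e t =>
    have h := hmono t (e 0) (e 1)
    rwa [mono, ← eq_expo, MvPolynomial.smul_monomial, smul_eq_mul, mul_one] at h
  | add p r hp hr => exact hadd p r hp hr

/-- The coefficient of `x^(m-1) y^k` in the image of `x^m y^k`; `X = q^m`, `Y = q^k`. -/
def w1 (q a b c d X Y : ℝ) : ℝ :=
  (X - 1) * (a * c * q ^ 2 / X - a * c * d * q ^ 2 * Y + d * q / (X * Y) - a * b * c * q ^ 2)

/-- The coefficient of `x^m y^(k-1)`. -/
def w2 (q a b c d X Y : ℝ) : ℝ :=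
  (Y - 1) * (d * q / Y - a * b * c * q ^ 2 * X + a * q / (X * Y) - a * d * q)

/-- The coefficient of `x^(m-2) y^k`. -/
def w11 (q a c d X : ℝ) : ℝ := a * c * d * q ^ 2 * (X - 1) * (X - q) / X

/-- The coefficient of `x^(m-1) y^(k-1)`. -/
def w12 (q a c d X Y : ℝ) : ℝ := a * d * q ^ 2 * (X - 1) * (Y - 1) * (c + 1 / (X * Y))

/-- The coefficient of `x^m y^(k-2)`. -/
def w22 (q a d Y : ℝ) : ℝ := a * d * q * (Y - 1) * (Y - q) / Y

variable (q a b c d : ℝ)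

/-- The image of `x^m y^k` under the normalized second-order operator. -/
def mImage (m k : ℕ) : MvPolynomial (Fin 2) ℝ :=
  mEig q a b c (q ^ (m + k)) • mono m k + w1 q a b c d (q ^ m) (q ^ k) • mono (m - 1) k
    + w2 q a b c d (q ^ m) (q ^ k) • mono m (k - 1) + w11 q a c d (q ^ m) • mono (m - 2) k
    + w12 q a c d (q ^ m) (q ^ k) • mono (m - 1) (k - 1) + w22 q a d (q ^ k) • mono m (k - 2)

/-- The normalized second-order operator on polynomials. -/
def mPoly : MvPolynomial (Fin 2) ℝ →ₗ[ℝ] MvPolynomial (Fin 2) ℝ :=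
  (MvPolynomial.basisMonomials (Fin 2) ℝ).constr ℝ fun e => mImage q a b c d (e 0) (e 1)

theorem mPoly_mono (m k : ℕ) : mPoly q a b c d (mono m k) = mImage q a b c d m k := by
  have h := (MvPolynomial.basisMonomials (Fin 2) ℝ).constr_basis ℝ
    (fun e => mImage q a b c d (e 0) (e 1)) (expo m k)
  rw [MvPolynomial.coe_basisMonomials, expo_zero, expo_one] at h
  exact h

variable {q}

/-- Truncated exponents in `mImage` do no harm: the factors `X - 1` and `X - q` (and likewise for
`Y`) annihilate every term whose exponent would be negative. So the coefficients can be read off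
without boundary cases. -/
theorem cf_mPoly (hq : q ≠ 0) (p : MvPolynomial (Fin 2) ℝ) (m k : ℕ) :
    cf (mPoly q a b c d p) m k = mEig q a b c (q ^ (m + k)) * cf p m k
      + w1 q a b c d (q ^ (m + 1)) (q ^ k) * cf p (m + 1) k
      + w2 q a b c d (q ^ m) (q ^ (k + 1)) * cf p m (k + 1)
      + w11 q a c d (q ^ (m + 2)) * cf p (m + 2) k
      + w12 q a c d (q ^ (m + 1)) (q ^ (k + 1)) * cf p (m + 1) (k + 1)
      + w22 q a d (q ^ (k + 2)) * cf p m (k + 2) := by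
  induction p using induction_mono with
  | hadd p r hp hr => simp only [map_add, cf_add, hp, hr]; ring
  | hmono t m' k' =>
    have h₁ : w1 q a b c d (q ^ m') (q ^ k') * cf (mono (m' - 1) k') m k
        = w1 q a b c d (q ^ (m + 1)) (q ^ k) * cf (mono m' k') (m + 1) k := by
      simp only [cf_mono]
      rcases m' with _ | m'
      · simp [w1]
      · by_cases h : m = m' ∧ k = k' <;> simp [h]
    have h₂ : w2 q a b c d (q ^ m') (q ^ k') * cf (mono m' (k' - 1)) m k
        = w2 q a b c d (q ^ m) (q ^ (k + 1)) * cf (mono m' k') m (k + 1) := by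
      simp only [cf_mono]
      rcases k' with _ | k'
      · simp [w2]
      · by_cases h : m = m' ∧ k = k' <;> simp [h]
    have h₃ : w11 q a c d (q ^ m') * cf (mono (m' - 2) k') m k
        = w11 q a c d (q ^ (m + 2)) * cf (mono m' k') (m + 2) k := by
      simp only [cf_mono]
      rcases m' with _ | _ | m'
      · simp [w11]
      · simp [w11]
      · by_cases h : m = m' ∧ k = k' <;> simp [h]
    have h₄ : w12 q a c d (q ^ m') (q ^ k') * cf (mono (m' - 1) (k' - 1)) m k
        = w12 q a c d (q ^ (m + 1)) (q ^ (k + 1)) * cf (mono m' k') (m + 1) (k + 1) := by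
      simp only [cf_mono]
      rcases m' with _ | m'
      · simp [w12]
      · rcases k' with _ | k'
        · simp [w12]
        · by_cases h : m = m' ∧ k = k' <;> simp [h]
    have h₅ : w22 q a d (q ^ k') * cf (mono m' (k' - 2)) m k
        = w22 q a d (q ^ (k + 2)) * cf (mono m' k') m (k + 2) := by
      simp only [cf_mono]
      rcases k' with _ | _ | k'
      · simp [w22]
      · simp [w22]
      · by_cases h : m = m' ∧ k = k' <;> simp [h]
    have h₀ : mEig q a b c (q ^ (m' + k')) * cf (mono m' k') m k
        = mEig q a b c (q ^ (m + k)) * cf (mono m' k') m k := by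
      simp only [cf_mono]
      by_cases h : m = m' ∧ k = k' <;> simp [h]
    simp only [map_smul, mPoly_mono, mImage, cf_smul, cf_add]
    linear_combination t * (h₀ + h₁ + h₂ + h₃ + h₄ + h₅)

/-- The function of two nonzero variables defined by a polynomial. -/
def evalU (p : MvPolynomial (Fin 2) ℝ) : UFun := restr (evalXY p)

theorem evalU_add (p r : MvPolynomial (Fin 2) ℝ) : evalU (p + r) = evalU p + evalU r := by
  ext x y; simp [evalU, restr, evalXY]

theorem evalU_sub (p r : MvPolynomial (Fin 2) ℝ) : evalU (p - r) = evalU p - evalU r := by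
  ext x y; simp [evalU, restr, evalXY]

theorem evalU_smul (t : ℝ) (p : MvPolynomial (Fin 2) ℝ) : evalU (t • p) = t • evalU p := by
  ext x y; simp [evalU, restr, evalXY, MvPolynomial.smul_eval]

theorem evalU_mono (m k : ℕ) (x y : ℝˣ) : evalU (mono m k) x y = (x : ℝ) ^ m * (y : ℝ) ^ k := by
  simp [evalU, restr, evalXY, mono_eq]

theorem evalU_X_mul (v : Fin 2) (p : MvPolynomial (Fin 2) ℝ) :
    evalU (MvPolynomial.X v * p) = mulVar v (evalU p) := by
  ext x y
  fin_cases v <;> simp [evalU, restr, evalXY, mulVar_apply]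

/-- Multiplication by `x y` turns equality off the axes into equality everywhere, and `x y` can be
cancelled in the polynomial ring. -/
theorem evalU_injective : Function.Injective evalU := by
  intro p r h
  have h₀ : MvPolynomial.X 0 * MvPolynomial.X 1 * (p - r) = 0 := by
    apply MvPolynomial.funext
    intro z
    by_cases h₁ : z 0 = 0
    · simp [h₁]
    by_cases h₂ : z 1 = 0
    · simp [h₂]
    have h₃ := congrFun (congrFun h (Units.mk0 _ h₁)) (Units.mk0 _ h₂)
    have hz : ![z 0, z 1] = z := by ext i; fin_cases i <;> rfl
    simp only [evalU, restr, evalXY, Units.val_mk0, hz] at h₃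
    simp [h₃]
  rcases mul_eq_zero.1 h₀ with h₁ | h₁
  · simp [MvPolynomial.X_ne_zero] at h₁
  · exact sub_eq_zero.1 h₁

/-- It suffices to compare on monomials, where a shift multiplies by a power of `u`. The vanishing
of the weights at small exponents allows `x ^ (m - 1)` to be replaced by `x ^ m / x`, and so on. -/
theorem mOp_evalU (u : ℝˣ) (hd : d ≠ 0) (p : MvPolynomial (Fin 2) ℝ) :
    mOp u a b c d (evalU p) = evalU (mPoly u a b c d p) := by
  induction p using induction_mono with
  | hadd p r hp hr => simp only [evalU_add, map_add, hp, hr]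
  | hmono t m k =>
    rw [evalU_smul, map_smul, map_smul, evalU_smul]
    congr 1
    ext x y
    have hx := x.ne_zero
    have hy := y.ne_zero
    have hu := u.ne_zero
    have h₁ : w1 u a b c d (u ^ m) (u ^ k) * ((x : ℝ) ^ (m - 1) * (y : ℝ) ^ k)
        = w1 u a b c d (u ^ m) (u ^ k) * ((x : ℝ) ^ m / x * (y : ℝ) ^ k) := by
      rcases m with _ | m
      · simp [w1]
      · simp [pow_succ, hx]
    have h₂ : w2 u a b c d (u ^ m) (u ^ k) * ((x : ℝ) ^ m * (y : ℝ) ^ (k - 1))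
        = w2 u a b c d (u ^ m) (u ^ k) * ((x : ℝ) ^ m * ((y : ℝ) ^ k / y)) := by
      rcases k with _ | k
      · simp [w2]
      · simp [pow_succ, hy]
    have h₃ : w11 u a c d (u ^ m) * ((x : ℝ) ^ (m - 2) * (y : ℝ) ^ k)
        = w11 u a c d (u ^ m) * ((x : ℝ) ^ m / x ^ 2 * (y : ℝ) ^ k) := by
      rcases m with _ | _ | m
      · simp [w11]
      · simp [w11]
      · have e : (x : ℝ) ^ (m + 1 + 1) / x ^ 2 = x ^ m := by
          rw [div_eq_iff (pow_ne_zero 2 hx)]; ring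
        simp [e]
    have h₄ : w12 u a c d (u ^ m) (u ^ k) * ((x : ℝ) ^ (m - 1) * (y : ℝ) ^ (k - 1))
        = w12 u a c d (u ^ m) (u ^ k) * ((x : ℝ) ^ m / x * ((y : ℝ) ^ k / y)) := by
      rcases m with _ | m
      · simp [w12]
      · rcases k with _ | k
        · simp [w12]
        · simp [pow_succ, hx, hy]
    have h₅ : w22 u a d (u ^ k) * ((x : ℝ) ^ m * (y : ℝ) ^ (k - 2))
        = w22 u a d (u ^ k) * ((x : ℝ) ^ m * ((y : ℝ) ^ k / y ^ 2)) := by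
      rcases k with _ | _ | k
      · simp [w22]
      · simp [w22]
      · have e : (y : ℝ) ^ (k + 1 + 1) / y ^ 2 = y ^ k := by
          rw [div_eq_iff (pow_ne_zero 2 hy)]; ring
        simp [e]
    rw [mPoly_mono, mImage]
    simp only [evalU_add, evalU_smul, Pi.add_apply, Pi.smul_apply, smul_eq_mul, evalU_mono,
      h₁, h₂, h₃, h₄, h₅]
    simp only [mOp, Module.End.mul_apply, LinearMap.add_apply, LinearMap.sub_apply,
      LinearMap.smul_apply, Pi.add_apply, Pi.sub_apply, Pi.smul_apply, shiftX_apply, shiftY_apply,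
      Module.End.one_apply, smul_eq_mul, evalU_mono, Units.val_mul, inv_mul_cancel_left,
      mul_inv_cancel_left, Units.val_inv_eq_inv_val, mul_pow, inv_pow, pow_add]
    have hX : (u : ℝ) ^ m ≠ 0 := pow_ne_zero _ hu
    have hY : (u : ℝ) ^ k ≠ 0 := pow_ne_zero _ hu
    simp only [mEig, w1, w2, w11, w12, w22]
    generalize (u : ℝ) ^ m = X at *
    generalize (u : ℝ) ^ k = Y at *
    generalize (x : ℝ) ^ m = x'
    generalize (y : ℝ) ^ k = y'
    field_simp
    ring

/-- Since `1 + a b c q ^ 2` is the eigenvalue for `n = 0`, the parameter `λ_n` is a multiple of an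
eigenvalue difference, with the same additive constant as in `qOp_eq_mOp`. -/
theorem lam_eq (hq : 0 < q) (hq1 : q ≠ 1) (n : ℕ) : (q - 1) ^ 2 * lam q a b c n
    = q ^ 2 * (1 + a * b * c * q ^ 2 - mEig q a b c (q ^ n)) := by
  have h : (q - 1 : ℝ) ≠ 0 := sub_ne_zero.2 hq1
  have hq0 := hq.ne'
  rw [lam, qNum, mEig, zpow_sub₀ hq0, zpow_add₀ hq0, zpow_natCast]
  norm_cast
  field_simp
  ring

/-- The partial `q`-difference equation is an eigenvalue equation. -/
theorem solution_iff (hq : 0 < q) (hq1 : q ≠ 1) (hd : d ≠ 0) (n : ℕ)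
    (p : MvPolynomial (Fin 2) ℝ) :
    (∀ x y : ℝ, x ≠ 0 → y ≠ 0 → qOp q a b c d (evalXY p) x y + lam q a b c n * evalXY p x y = 0) ↔
      mPoly q a b c d p = mEig q a b c (q ^ n) • p := by
  have h : (q - 1 : ℝ) ≠ 0 := sub_ne_zero.2 hq1
  obtain ⟨u, rfl⟩ : ∃ u : ℝˣ, (u : ℝ) = q := ⟨Units.mk0 q hq.ne', rfl⟩
  have key (x y : ℝˣ) : (u - 1 : ℝ) ^ 2
      * (qOp u a b c d (evalXY p) x y + lam u a b c n * evalXY p x y)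
      = u ^ 2 * (evalU (mPoly u a b c d p) x y - mEig u a b c (u ^ n) * evalU p x y) := by
    rw [mul_add, qOp_eq_mOp u a b c hd hq hq1, ← mOp_evalU a b c d u hd, ← mul_assoc,
      lam_eq a b c hq hq1, evalU]
    simp only [restr]
    ring
  constructor
  · intro H
    apply evalU_injective
    ext x y
    have h₁ := key x y
    rw [H x y x.ne_zero y.ne_zero, mul_zero, eq_comm, mul_eq_zero] at h₁
    rw [evalU_smul, Pi.smul_apply, Pi.smul_apply, smul_eq_mul]
    exact sub_eq_zero.1 (h₁.resolve_left (pow_ne_zero _ u.ne_zero))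
  · intro H x y hx hy
    have h₁ := key (Units.mk0 x hx) (Units.mk0 y hy)
    rw [H, evalU_smul, Pi.smul_apply, Pi.smul_apply, smul_eq_mul, sub_self, mul_zero,
      mul_eq_zero] at h₁
    exact h₁.resolve_left (pow_ne_zero _ h)

/-- A coordinate times an eigenvector for `q^n` is a sum of eigenvectors for
`q^(n+1)`, `q^n` and `q^(n-1)`. -/
theorem X_mul_eigenvector (hq : q ≠ 0) (hd : d ≠ 0) (ha : a ≠ 0) (hc : c ≠ 0) (v : Fin 2) (n : ℕ)
    {p : MvPolynomial (Fin 2) ℝ} (hp : mPoly q a b c d p = mEig q a b c (q ^ (n + 1)) • p) :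
    let S (j : ℕ) (r : MvPolynomial (Fin 2) ℝ) := mPoly q a b c d r - mEig q a b c (q ^ j) • r
    S n (S (n + 2) (S (n + 1) (MvPolynomial.X v * p))) = 0 := by
  intro S
  obtain ⟨u, rfl⟩ : ∃ u : ℝˣ, (u : ℝ) = q := ⟨Units.mk0 q hq, rfl⟩
  have h := mulVar_eigenfunction u a b c hd ha hc v (pow_ne_zero (n + 1) hq)
    (f := evalU p) (by rw [mOp_evalU _ _ _ _ _ hd, hp, evalU_smul])
  have hS (j : ℕ) (r : MvPolynomial (Fin 2) ℝ) :
      (mOp u a b c d - mEig u a b c (u ^ j) • 1) (evalU r) = evalU (S j r) := by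
    simp only [S, evalU_sub, evalU_smul, LinearMap.sub_apply, LinearMap.smul_apply,
      Module.End.one_apply, mOp_evalU a b c d u hd]
  have e₁ : (u : ℝ) ^ (n + 1) / u = u ^ n := by rw [pow_succ]; field_simp
  have e₂ : (u : ℝ) ^ (n + 1) * u = u ^ (n + 2) := by ring
  rw [e₁, e₂] at h
  simp only at h
  rw [← evalU_X_mul, hS, hS, hS] at h
  apply evalU_injective
  rw [h]
  ext x y
  simp [evalU, restr, evalXY]

/-! ### Subleading coefficients and the recurrence coefficients -/

section Coefficients

variable (q a b c d X Y : ℝ)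

/-- The coefficient of `x^(m-1) y^k` in the monic solution; `X = q^m`, `Y = q^k`. -/
def g1 : ℝ := w1 q a b c d X Y / (mEig q a b c (X * Y) - mEig q a b c (X * Y / q))

/-- The coefficient of `x^m y^(k-1)`. -/
def g2 : ℝ := w2 q a b c d X Y / (mEig q a b c (X * Y) - mEig q a b c (X * Y / q))

/-- The coefficient of `x^(m-2) y^k`. -/
def h11 : ℝ := (w11 q a c d X + w1 q a b c d (X / q) Y * g1 q a b c d X Y)
  / (mEig q a b c (X * Y) - mEig q a b c (X * Y / q ^ 2))

/-- The coefficient of `x^(m-1) y^(k-1)`. -/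
def h12 : ℝ := (w12 q a c d X Y + w1 q a b c d X (Y / q) * g2 q a b c d X Y
    + w2 q a b c d (X / q) Y * g1 q a b c d X Y)
  / (mEig q a b c (X * Y) - mEig q a b c (X * Y / q ^ 2))

/-- The coefficient of `x^m y^(k-2)`. -/
def h22 : ℝ := (w22 q a d Y + w2 q a b c d X (Y / q) * g2 q a b c d X Y)
  / (mEig q a b c (X * Y) - mEig q a b c (X * Y / q ^ 2))

variable {q X Y}

/-- At `t = q ^ n`, the gaps to degrees `n - 1` and `n - 2` contain `Δ_{2n+1}` and `Δ_{2n}`. They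
are the source of all denominators in the displayed entries. -/
theorem mEig_sub (hq : q ≠ 0) {t : ℝ} (ht : t ≠ 0) :
    mEig q a b c t - mEig q a b c (t / q) = (q - 1) * (a * b * c * q * t ^ 2 - 1) / t := by
  rw [mEig, mEig]; field_simp; ring

theorem mEig_sub_two (hq : q ≠ 0) {t : ℝ} (ht : t ≠ 0) :
    mEig q a b c t - mEig q a b c (t / q ^ 2)
      = (q - 1) * (q + 1) * (a * b * c * t ^ 2 - 1) / t := by
  rw [mEig, mEig]; field_simp; ring

/-- The factor of the denominator is kept as a letter `D`, so that fractions can be cleared before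
it is expanded. -/
theorem g1_eq (hq : q ≠ 0) (hX : X ≠ 0) (hY : Y ≠ 0) {D : ℝ}
    (hD : a * b * c * q * (X * Y) ^ 2 - 1 = D) :
    g1 q a b c d X Y = (X - 1) * q * (a * c * q * Y - a * c * d * q * X * Y ^ 2 + d
      - a * b * c * q * X * Y) / ((q - 1) * D) := by
  rw [g1, mEig_sub _ _ _ hq (mul_ne_zero hX hY), hD, w1, div_div_eq_mul_div]
  congr 1
  field_simp

theorem g2_eq (hq : q ≠ 0) (hX : X ≠ 0) (hY : Y ≠ 0) {D : ℝ}
    (hD : a * b * c * q * (X * Y) ^ 2 - 1 = D) :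
    g2 q a b c d X Y = (Y - 1) * q * (d * X - a * b * c * q * X ^ 2 * Y + a - a * d * X * Y)
      / ((q - 1) * D) := by
  rw [g2, mEig_sub _ _ _ hq (mul_ne_zero hX hY), hD, w2, div_div_eq_mul_div]
  congr 1
  field_simp

theorem h11_eq (hq : q ≠ 0) (hX : X ≠ 0) (hY : Y ≠ 0) {E : ℝ}
    (hE : a * b * c * (X * Y) ^ 2 - 1 = E) :
    h11 q a b c d X Y = (w11 q a c d X + w1 q a b c d (X / q) Y * g1 q a b c d X Y) * (X * Y)
      / ((q - 1) * (q + 1) * E) := by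
  rw [h11, mEig_sub_two _ _ _ hq (mul_ne_zero hX hY), hE, div_div_eq_mul_div]

theorem h12_eq (hq : q ≠ 0) (hX : X ≠ 0) (hY : Y ≠ 0) {E : ℝ}
    (hE : a * b * c * (X * Y) ^ 2 - 1 = E) :
    h12 q a b c d X Y = (w12 q a c d X Y + w1 q a b c d X (Y / q) * g2 q a b c d X Y
        + w2 q a b c d (X / q) Y * g1 q a b c d X Y) * (X * Y) / ((q - 1) * (q + 1) * E) := by
  rw [h12, mEig_sub_two _ _ _ hq (mul_ne_zero hX hY), hE, div_div_eq_mul_div]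

theorem h22_eq (hq : q ≠ 0) (hX : X ≠ 0) (hY : Y ≠ 0) {E : ℝ}
    (hE : a * b * c * (X * Y) ^ 2 - 1 = E) :
    h22 q a b c d X Y = (w22 q a d Y + w2 q a b c d X (Y / q) * g2 q a b c d X Y) * (X * Y)
      / ((q - 1) * (q + 1) * E) := by
  rw [h22, mEig_sub_two _ _ _ hq (mul_ne_zero hX hY), hE, div_div_eq_mul_div]

variable (q X Y) in
/-- The diagonal entries of `B_{n,1}`. -/
def bX0 : ℝ := g1 q a b c d X Y - g1 q a b c d (q * X) Y

variable (q X Y) in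
/-- The subdiagonal entries of `B_{n,1}`. -/
def bX1 : ℝ := g2 q a b c d X Y - g2 q a b c d (q * X) Y

variable (q X Y) in
/-- The diagonal entries of `B_{n,2}`. -/
def bY0 : ℝ := g2 q a b c d X Y - g2 q a b c d X (q * Y)

variable (q X Y) in
/-- The superdiagonal entries of `B_{n,2}`. -/
def bY1 : ℝ := g1 q a b c d X Y - g1 q a b c d X (q * Y)

variable (q X Y) in
/-- The diagonal entries of `C_{n,1}`. -/
def cX0 : ℝ := h11 q a b c d X Y - h11 q a b c d (q * X) Y
  - bX0 q a b c d X Y * g1 q a b c d X Y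

variable (q X Y) in
/-- The first subdiagonal of `C_{n,1}`. -/
def cX1 : ℝ := h12 q a b c d X Y - h12 q a b c d (q * X) Y
  - bX0 q a b c d X Y * g2 q a b c d X Y - bX1 q a b c d X Y * g1 q a b c d (q * X) (Y / q)

variable (q X Y) in
/-- The second subdiagonal of `C_{n,1}`. -/
def cX2 : ℝ := h22 q a b c d X Y - h22 q a b c d (q * X) Y
  - bX1 q a b c d X Y * g2 q a b c d (q * X) (Y / q)

variable (q X Y) in
/-- The diagonal entries of `C_{n,2}`. -/
def cY0 : ℝ := h12 q a b c d X Y - h12 q a b c d X (q * Y)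
  - bY0 q a b c d X Y * g1 q a b c d X Y - bY1 q a b c d X Y * g2 q a b c d (X / q) (q * Y)

variable (q X Y) in
/-- The superdiagonal entries of `C_{n,2}`. -/
def cY1 : ℝ := h11 q a b c d X Y - h11 q a b c d X (q * Y)
  - bY1 q a b c d X Y * g1 q a b c d (X / q) (q * Y)

variable (q X Y) in
/-- The subdiagonal entries of `C_{n,2}`. -/
def cY2 : ℝ := h22 q a b c d X Y - h22 q a b c d X (q * Y)
  - bY0 q a b c d X Y * g2 q a b c d X Y

/-! ### The displayed entries as rational functions of `q ^ m` and `q ^ k` -/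

theorem zpow_two_mul_add (hq : q ≠ 0) (m k r : ℤ) :
    q ^ (2 * (m + k) + r) = q ^ r * (q ^ m * q ^ k) ^ 2 := by
  rw [← zpow_add₀ hq, zpow_add₀ hq, mul_comm 2 (m + k), zpow_mul, mul_comm]
  norm_cast

theorem zpow_two_mul (hq : q ≠ 0) (m k : ℤ) : q ^ (2 * (m + k)) = (q ^ m * q ^ k) ^ 2 := by
  rw [← zpow_add₀ hq, mul_comm 2 (m + k), zpow_mul]
  norm_cast

/-- Row `k + 1` in the numbering from `1` belongs to the leading monomial `x^m y^k`, with `n = m +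
k`. Once the powers are split, a rational identity in `X = q ^ m` and `Y = q ^ k` remains. -/
theorem entryB1_diag (hq : q ≠ 0) (hq1 : q - 1 ≠ 0) (m k : ℤ)
    (h₁ : a * b * c * q ^ (2 * (m + k) + 1) - 1 ≠ 0)
    (h₃ : a * b * c * q ^ (2 * (m + k) + 3) - 1 ≠ 0) :
    entryB1 q a b c d (m + k) (k + 1) (k + 1) = bX0 q a b c d (q ^ m) (q ^ k) := by
  have hX : q ^ m ≠ 0 := zpow_ne_zero _ hq
  have hY : q ^ k ≠ 0 := zpow_ne_zero _ hq
  obtain ⟨D, hD⟩ : ∃ D, a * b * c * q ^ (2 * (m + k) + 1) - 1 = D := ⟨_, rfl⟩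
  obtain ⟨D', hD'⟩ : ∃ D, a * b * c * q ^ (2 * (m + k) + 3) - 1 = D := ⟨_, rfl⟩
  rw [entryB1, if_pos rfl, hD, hD']
  rw [hD] at h₁
  rw [hD'] at h₃
  have e₁ : a * b * c * q * (q ^ m * q ^ k) ^ 2 - 1 = D := by
    rw [← hD, zpow_two_mul_add hq]; norm_cast; ring
  have e₃ : a * b * c * q * (q * q ^ m * q ^ k) ^ 2 - 1 = D' := by
    rw [← hD', zpow_two_mul_add hq]; norm_cast; ring
  rw [bX0, g1_eq _ _ _ _ hq hX hY e₁, g1_eq _ _ _ _ hq (mul_ne_zero hq hX) hY e₃]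
  simp only [zpow_add₀ hq, zpow_sub₀ hq, zpow_neg, zpow_mul', zpow_one, zpow_ofNat, qNum]
  clear hD hD'
  generalize q ^ m = X at *
  generalize q ^ k = Y at *
  field_simp
  rw [← e₁, ← e₃]
  ring

theorem entryB1_sub (hq : q ≠ 0) (hq1 : q - 1 ≠ 0) (m k : ℤ)
    (h₁ : a * b * c * q ^ (2 * (m + k) + 1) - 1 ≠ 0)
    (h₃ : a * b * c * q ^ (2 * (m + k) + 3) - 1 ≠ 0) :
    entryB1 q a b c d (m + k) (k + 1) k = bX1 q a b c d (q ^ m) (q ^ k) := by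
  have hX : q ^ m ≠ 0 := zpow_ne_zero _ hq
  have hY : q ^ k ≠ 0 := zpow_ne_zero _ hq
  obtain ⟨D, hD⟩ : ∃ D, a * b * c * q ^ (2 * (m + k) + 1) - 1 = D := ⟨_, rfl⟩
  obtain ⟨D', hD'⟩ : ∃ D, a * b * c * q ^ (2 * (m + k) + 3) - 1 = D := ⟨_, rfl⟩
  rw [entryB1, if_neg (by omega), if_pos rfl, hD, hD']
  rw [hD] at h₁
  rw [hD'] at h₃
  have e₁ : a * b * c * q * (q ^ m * q ^ k) ^ 2 - 1 = D := by
    rw [← hD, zpow_two_mul_add hq]; norm_cast; ring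
  have e₃ : a * b * c * q * (q * q ^ m * q ^ k) ^ 2 - 1 = D' := by
    rw [← hD', zpow_two_mul_add hq]; norm_cast; ring
  rw [bX1, g2_eq _ _ _ _ hq hX hY e₁, g2_eq _ _ _ _ hq (mul_ne_zero hq hX) hY e₃]
  simp only [zpow_add₀ hq, zpow_sub₀ hq, zpow_neg, zpow_mul', zpow_one, zpow_ofNat, qNum]
  clear hD hD'
  generalize q ^ m = X at *
  generalize q ^ k = Y at *
  field_simp
  rw [← e₁, ← e₃]
  ring

theorem entryB2_diag (hq : q ≠ 0) (hq1 : q - 1 ≠ 0) (m k : ℤ)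
    (h₁ : a * b * c * q ^ (2 * (m + k) + 1) - 1 ≠ 0)
    (h₃ : a * b * c * q ^ (2 * (m + k) + 3) - 1 ≠ 0) :
    entryB2 q a b c d (m + k) (k + 1) (k + 1) = bY0 q a b c d (q ^ m) (q ^ k) := by
  have hX : q ^ m ≠ 0 := zpow_ne_zero _ hq
  have hY : q ^ k ≠ 0 := zpow_ne_zero _ hq
  obtain ⟨D, hD⟩ : ∃ D, a * b * c * q ^ (2 * (m + k) + 1) - 1 = D := ⟨_, rfl⟩
  obtain ⟨D', hD'⟩ : ∃ D, a * b * c * q ^ (2 * (m + k) + 3) - 1 = D := ⟨_, rfl⟩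
  rw [entryB2, if_pos rfl, hD, hD']
  rw [hD] at h₁
  rw [hD'] at h₃
  have e₁ : a * b * c * q * (q ^ m * q ^ k) ^ 2 - 1 = D := by
    rw [← hD, zpow_two_mul_add hq]; norm_cast; ring
  have e₃ : a * b * c * q * (q ^ m * (q * q ^ k)) ^ 2 - 1 = D' := by
    rw [← hD', zpow_two_mul_add hq]; norm_cast; ring
  rw [bY0, g2_eq _ _ _ _ hq hX hY e₁, g2_eq _ _ _ _ hq hX (mul_ne_zero hq hY) e₃]
  simp only [zpow_add₀ hq, zpow_sub₀ hq, zpow_neg, zpow_mul', zpow_one, zpow_ofNat, qNum]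
  clear hD hD'
  generalize q ^ m = X at *
  generalize q ^ k = Y at *
  field_simp
  rw [← e₁, ← e₃]
  ring

theorem entryB2_sup (hq : q ≠ 0) (hq1 : q - 1 ≠ 0) (m k : ℤ)
    (h₁ : a * b * c * q ^ (2 * (m + k) + 1) - 1 ≠ 0)
    (h₃ : a * b * c * q ^ (2 * (m + k) + 3) - 1 ≠ 0) :
    entryB2 q a b c d (m + k) (k + 1) (k + 2) = bY1 q a b c d (q ^ m) (q ^ k) := by
  have hX : q ^ m ≠ 0 := zpow_ne_zero _ hq
  have hY : q ^ k ≠ 0 := zpow_ne_zero _ hq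
  obtain ⟨D, hD⟩ : ∃ D, a * b * c * q ^ (2 * (m + k) + 1) - 1 = D := ⟨_, rfl⟩
  obtain ⟨D', hD'⟩ : ∃ D, a * b * c * q ^ (2 * (m + k) + 3) - 1 = D := ⟨_, rfl⟩
  rw [entryB2, if_neg (by omega), if_pos (by omega), hD, hD']
  rw [hD] at h₁
  rw [hD'] at h₃
  have e₁ : a * b * c * q * (q ^ m * q ^ k) ^ 2 - 1 = D := by
    rw [← hD, zpow_two_mul_add hq]; norm_cast; ring
  have e₃ : a * b * c * q * (q ^ m * (q * q ^ k)) ^ 2 - 1 = D' := by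
    rw [← hD', zpow_two_mul_add hq]; norm_cast; ring
  rw [bY1, g1_eq _ _ _ _ hq hX hY e₁, g1_eq _ _ _ _ hq hX (mul_ne_zero hq hY) e₃]
  simp only [zpow_add₀ hq, zpow_sub₀ hq, zpow_neg, zpow_mul', zpow_one, zpow_ofNat, qNum]
  clear hD hD'
  generalize q ^ m = X at *
  generalize q ^ k = Y at *
  field_simp
  rw [← e₁, ← e₃]
  ring

set_option maxHeartbeats 2000000

/-- The factor `Δ_{2n+3}` does not occur in the displayed denominator, but it occurs in `bX0` and in
`h11` at `q * X`. It cancels in the combination `cX0`. -/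
theorem entryC1_diag (hq : q ≠ 0) (hq1 : q - 1 ≠ 0) (hq2 : q + 1 ≠ 0) (m k : ℤ)
    (h₀ : a * b * c * q ^ (2 * (m + k)) - 1 ≠ 0)
    (h₁ : a * b * c * q ^ (2 * (m + k) + 1) - 1 ≠ 0)
    (h₂ : a * b * c * q ^ (2 * (m + k) + 2) - 1 ≠ 0)
    (h₃ : a * b * c * q ^ (2 * (m + k) + 3) - 1 ≠ 0) :
    entryC1 q a b c d (m + k) (k + 1) (k + 1) = cX0 q a b c d (q ^ m) (q ^ k) := by
  have hX : q ^ m ≠ 0 := zpow_ne_zero _ hq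
  have hY : q ^ k ≠ 0 := zpow_ne_zero _ hq
  obtain ⟨E, hE⟩ : ∃ D, a * b * c * q ^ (2 * (m + k)) - 1 = D := ⟨_, rfl⟩
  obtain ⟨D, hD⟩ : ∃ D, a * b * c * q ^ (2 * (m + k) + 1) - 1 = D := ⟨_, rfl⟩
  obtain ⟨E', hE'⟩ : ∃ D, a * b * c * q ^ (2 * (m + k) + 2) - 1 = D := ⟨_, rfl⟩
  obtain ⟨D', hD'⟩ : ∃ D, a * b * c * q ^ (2 * (m + k) + 3) - 1 = D := ⟨_, rfl⟩
  rw [entryC1, if_pos rfl, denC, hD, hE, hE']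
  rw [hE] at h₀
  rw [hD] at h₁
  rw [hE'] at h₂
  rw [hD'] at h₃
  have e₀ : a * b * c * (q ^ m * q ^ k) ^ 2 - 1 = E := by rw [← hE, zpow_two_mul hq]
  have e₁ : a * b * c * q * (q ^ m * q ^ k) ^ 2 - 1 = D := by
    rw [← hD, zpow_two_mul_add hq]; norm_cast; ring
  have e₂ : a * b * c * (q * q ^ m * q ^ k) ^ 2 - 1 = E' := by
    rw [← hE', zpow_two_mul_add hq]; norm_cast; ring
  have e₃ : a * b * c * q * (q * q ^ m * q ^ k) ^ 2 - 1 = D' := by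
    rw [← hD', zpow_two_mul_add hq]; norm_cast; ring
  have e₄ : a * b * c * q * (q * q ^ m * (q ^ k / q)) ^ 2 - 1 = D := by rw [← e₁]; field_simp
  rw [cX0, h11_eq _ _ _ _ hq hX hY e₀, h11_eq _ _ _ _ hq (mul_ne_zero hq hX) hY e₂, bX0]
  simp only [g1_eq _ _ _ _ hq hX hY e₁, g2_eq _ _ _ _ hq hX hY e₁,
    g1_eq _ _ _ _ hq (mul_ne_zero hq hX) hY e₃, g2_eq _ _ _ _ hq (mul_ne_zero hq hX) hY e₃]
  simp only [zpow_add₀ hq, zpow_sub₀ hq, zpow_neg, zpow_mul', zpow_one, zpow_ofNat, qNum,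
    w1, w2, w11, w12, w22]
  clear hD hD' hE hE'
  generalize q ^ m = X at *
  generalize q ^ k = Y at *
  field_simp
  rw [← e₀, ← e₁, ← e₂, ← e₃]
  ring

theorem entryC1_sub (hq : q ≠ 0) (hq1 : q - 1 ≠ 0) (hq2 : q + 1 ≠ 0) (m k : ℤ)
    (h₀ : a * b * c * q ^ (2 * (m + k)) - 1 ≠ 0)
    (h₁ : a * b * c * q ^ (2 * (m + k) + 1) - 1 ≠ 0)
    (h₂ : a * b * c * q ^ (2 * (m + k) + 2) - 1 ≠ 0)
    (h₃ : a * b * c * q ^ (2 * (m + k) + 3) - 1 ≠ 0) :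
    entryC1 q a b c d (m + k) (k + 1) k = cX1 q a b c d (q ^ m) (q ^ k) := by
  have hX : q ^ m ≠ 0 := zpow_ne_zero _ hq
  have hY : q ^ k ≠ 0 := zpow_ne_zero _ hq
  obtain ⟨E, hE⟩ : ∃ D, a * b * c * q ^ (2 * (m + k)) - 1 = D := ⟨_, rfl⟩
  obtain ⟨D, hD⟩ : ∃ D, a * b * c * q ^ (2 * (m + k) + 1) - 1 = D := ⟨_, rfl⟩
  obtain ⟨E', hE'⟩ : ∃ D, a * b * c * q ^ (2 * (m + k) + 2) - 1 = D := ⟨_, rfl⟩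
  obtain ⟨D', hD'⟩ : ∃ D, a * b * c * q ^ (2 * (m + k) + 3) - 1 = D := ⟨_, rfl⟩
  rw [entryC1, if_neg (by omega), if_pos rfl, denC, hD, hE, hE']
  rw [hE] at h₀
  rw [hD] at h₁
  rw [hE'] at h₂
  rw [hD'] at h₃
  have e₀ : a * b * c * (q ^ m * q ^ k) ^ 2 - 1 = E := by rw [← hE, zpow_two_mul hq]
  have e₁ : a * b * c * q * (q ^ m * q ^ k) ^ 2 - 1 = D := by
    rw [← hD, zpow_two_mul_add hq]; norm_cast; ring
  have e₂ : a * b * c * (q * q ^ m * q ^ k) ^ 2 - 1 = E' := by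
    rw [← hE', zpow_two_mul_add hq]; norm_cast; ring
  have e₃ : a * b * c * q * (q * q ^ m * q ^ k) ^ 2 - 1 = D' := by
    rw [← hD', zpow_two_mul_add hq]; norm_cast; ring
  -- Passing to the neighbouring polynomial of the same degree keeps `X * Y`, hence also the
  -- denominator.
  have e₄ : a * b * c * q * (q * q ^ m * (q ^ k / q)) ^ 2 - 1 = D := by rw [← e₁]; field_simp
  rw [cX1, h12_eq _ _ _ _ hq hX hY e₀, h12_eq _ _ _ _ hq (mul_ne_zero hq hX) hY e₂, bX0, bX1]
  simp only [g1_eq _ _ _ _ hq hX hY e₁, g2_eq _ _ _ _ hq hX hY e₁,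
    g1_eq _ _ _ _ hq (mul_ne_zero hq hX) hY e₃, g2_eq _ _ _ _ hq (mul_ne_zero hq hX) hY e₃, g1_eq _ _ _ _ hq (mul_ne_zero hq hX) (div_ne_zero hY hq) e₄]
  simp only [zpow_add₀ hq, zpow_sub₀ hq, zpow_neg, zpow_mul', zpow_one, zpow_ofNat, qNum,
    w1, w2, w11, w12, w22]
  clear hD hD' hE hE'
  generalize q ^ m = X at *
  generalize q ^ k = Y at *
  field_simp
  rw [← e₀, ← e₁, ← e₂, ← e₃]
  ring

theorem entryC2_diag (hq : q ≠ 0) (hq1 : q - 1 ≠ 0) (hq2 : q + 1 ≠ 0) (m k : ℤ)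
    (h₀ : a * b * c * q ^ (2 * (m + k)) - 1 ≠ 0)
    (h₁ : a * b * c * q ^ (2 * (m + k) + 1) - 1 ≠ 0)
    (h₂ : a * b * c * q ^ (2 * (m + k) + 2) - 1 ≠ 0)
    (h₃ : a * b * c * q ^ (2 * (m + k) + 3) - 1 ≠ 0) :
    entryC2 q a b c d (m + k) (k + 1) (k + 1) = cY0 q a b c d (q ^ m) (q ^ k) := by
  have hX : q ^ m ≠ 0 := zpow_ne_zero _ hq
  have hY : q ^ k ≠ 0 := zpow_ne_zero _ hq
  obtain ⟨E, hE⟩ : ∃ D, a * b * c * q ^ (2 * (m + k)) - 1 = D := ⟨_, rfl⟩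
  obtain ⟨D, hD⟩ : ∃ D, a * b * c * q ^ (2 * (m + k) + 1) - 1 = D := ⟨_, rfl⟩
  obtain ⟨E', hE'⟩ : ∃ D, a * b * c * q ^ (2 * (m + k) + 2) - 1 = D := ⟨_, rfl⟩
  obtain ⟨D', hD'⟩ : ∃ D, a * b * c * q ^ (2 * (m + k) + 3) - 1 = D := ⟨_, rfl⟩
  rw [entryC2, if_pos rfl, denC, hD, hE, hE']
  rw [hE] at h₀
  rw [hD] at h₁
  rw [hE'] at h₂
  rw [hD'] at h₃
  have e₀ : a * b * c * (q ^ m * q ^ k) ^ 2 - 1 = E := by rw [← hE, zpow_two_mul hq]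
  have e₁ : a * b * c * q * (q ^ m * q ^ k) ^ 2 - 1 = D := by
    rw [← hD, zpow_two_mul_add hq]; norm_cast; ring
  have e₂ : a * b * c * (q ^ m * (q * q ^ k)) ^ 2 - 1 = E' := by
    rw [← hE', zpow_two_mul_add hq]; norm_cast; ring
  have e₃ : a * b * c * q * (q ^ m * (q * q ^ k)) ^ 2 - 1 = D' := by
    rw [← hD', zpow_two_mul_add hq]; norm_cast; ring
  have e₄ : a * b * c * q * (q ^ m / q * (q * q ^ k)) ^ 2 - 1 = D := by rw [← e₁]; field_simp
  rw [cY0, h12_eq _ _ _ _ hq hX hY e₀, h12_eq _ _ _ _ hq hX (mul_ne_zero hq hY) e₂, bY0, bY1]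
  simp only [g1_eq _ _ _ _ hq hX hY e₁, g2_eq _ _ _ _ hq hX hY e₁,
    g1_eq _ _ _ _ hq hX (mul_ne_zero hq hY) e₃, g2_eq _ _ _ _ hq hX (mul_ne_zero hq hY) e₃, g2_eq _ _ _ _ hq (div_ne_zero hX hq) (mul_ne_zero hq hY) e₄]
  simp only [zpow_add₀ hq, zpow_sub₀ hq, zpow_neg, zpow_mul', zpow_one, zpow_ofNat, qNum,
    w1, w2, w11, w12, w22]
  clear hD hD' hE hE'
  generalize q ^ m = X at *
  generalize q ^ k = Y at *
  field_simp
  rw [← e₀, ← e₁, ← e₂, ← e₃]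
  ring

theorem entryC2_sub (hq : q ≠ 0) (hq1 : q - 1 ≠ 0) (hq2 : q + 1 ≠ 0) (m k : ℤ)
    (h₀ : a * b * c * q ^ (2 * (m + k)) - 1 ≠ 0)
    (h₁ : a * b * c * q ^ (2 * (m + k) + 1) - 1 ≠ 0)
    (h₂ : a * b * c * q ^ (2 * (m + k) + 2) - 1 ≠ 0)
    (h₃ : a * b * c * q ^ (2 * (m + k) + 3) - 1 ≠ 0) :
    entryC2 q a b c d (m + k) (k + 1) k = cY2 q a b c d (q ^ m) (q ^ k) := by
  have hX : q ^ m ≠ 0 := zpow_ne_zero _ hq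
  have hY : q ^ k ≠ 0 := zpow_ne_zero _ hq
  obtain ⟨E, hE⟩ : ∃ D, a * b * c * q ^ (2 * (m + k)) - 1 = D := ⟨_, rfl⟩
  obtain ⟨D, hD⟩ : ∃ D, a * b * c * q ^ (2 * (m + k) + 1) - 1 = D := ⟨_, rfl⟩
  obtain ⟨E', hE'⟩ : ∃ D, a * b * c * q ^ (2 * (m + k) + 2) - 1 = D := ⟨_, rfl⟩
  obtain ⟨D', hD'⟩ : ∃ D, a * b * c * q ^ (2 * (m + k) + 3) - 1 = D := ⟨_, rfl⟩
  rw [entryC2, if_neg (by omega), if_pos rfl, denC, hD, hE, hE']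
  rw [hE] at h₀
  rw [hD] at h₁
  rw [hE'] at h₂
  rw [hD'] at h₃
  have e₀ : a * b * c * (q ^ m * q ^ k) ^ 2 - 1 = E := by rw [← hE, zpow_two_mul hq]
  have e₁ : a * b * c * q * (q ^ m * q ^ k) ^ 2 - 1 = D := by
    rw [← hD, zpow_two_mul_add hq]; norm_cast; ring
  have e₂ : a * b * c * (q ^ m * (q * q ^ k)) ^ 2 - 1 = E' := by
    rw [← hE', zpow_two_mul_add hq]; norm_cast; ring
  have e₃ : a * b * c * q * (q ^ m * (q * q ^ k)) ^ 2 - 1 = D' := by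
    rw [← hD', zpow_two_mul_add hq]; norm_cast; ring
  have e₄ : a * b * c * q * (q ^ m / q * (q * q ^ k)) ^ 2 - 1 = D := by rw [← e₁]; field_simp
  rw [cY2, h22_eq _ _ _ _ hq hX hY e₀, h22_eq _ _ _ _ hq hX (mul_ne_zero hq hY) e₂, bY0]
  simp only [g1_eq _ _ _ _ hq hX hY e₁, g2_eq _ _ _ _ hq hX hY e₁,
    g1_eq _ _ _ _ hq hX (mul_ne_zero hq hY) e₃, g2_eq _ _ _ _ hq hX (mul_ne_zero hq hY) e₃]
  simp only [zpow_add₀ hq, zpow_sub₀ hq, zpow_neg, zpow_mul', zpow_one, zpow_ofNat, qNum,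
    w1, w2, w11, w12, w22]
  clear hD hD' hE hE'
  generalize q ^ m = X at *
  generalize q ^ k = Y at *
  field_simp
  rw [← e₀, ← e₁, ← e₂, ← e₃]
  ring

/-- The quotient of `q`-factorials is the product `(1 - q ^ (k - 1)) (1 - q ^ k)`. It enters as the
hypothesis `hp`, which is supplied later for natural numbers `k ≥ 2`. -/
theorem entryC1_sub_sub (hq : q ≠ 0) (hq1 : q - 1 ≠ 0) (hq2 : q + 1 ≠ 0) (m k : ℤ)
    (h₀ : a * b * c * q ^ (2 * (m + k)) - 1 ≠ 0)
    (h₁ : a * b * c * q ^ (2 * (m + k) + 1) - 1 ≠ 0)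
    (h₂ : a * b * c * q ^ (2 * (m + k) + 2) - 1 ≠ 0)
    (h₃ : a * b * c * q ^ (2 * (m + k) + 3) - 1 ≠ 0)
    (hF : qPoch q q (k + 1 - 3).toNat ≠ 0)
    (hp : qPoch q q (k + 1 - 1).toNat
      = qPoch q q (k + 1 - 3).toNat * ((1 - q ^ k / q) * (1 - q ^ k))) :
    entryC1 q a b c d (m + k) (k + 1) (k - 1) = cX2 q a b c d (q ^ m) (q ^ k) := by
  have hX : q ^ m ≠ 0 := zpow_ne_zero _ hq
  have hY : q ^ k ≠ 0 := zpow_ne_zero _ hq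
  obtain ⟨E, hE⟩ : ∃ D, a * b * c * q ^ (2 * (m + k)) - 1 = D := ⟨_, rfl⟩
  obtain ⟨D, hD⟩ : ∃ D, a * b * c * q ^ (2 * (m + k) + 1) - 1 = D := ⟨_, rfl⟩
  obtain ⟨E', hE'⟩ : ∃ D, a * b * c * q ^ (2 * (m + k) + 2) - 1 = D := ⟨_, rfl⟩
  obtain ⟨D', hD'⟩ : ∃ D, a * b * c * q ^ (2 * (m + k) + 3) - 1 = D := ⟨_, rfl⟩
  rw [entryC1, if_neg (by omega), if_neg (by omega), if_pos (by omega), denC, hp, hD, hE, hE']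
  rw [hE] at h₀
  rw [hD] at h₁
  rw [hE'] at h₂
  rw [hD'] at h₃
  have e₀ : a * b * c * (q ^ m * q ^ k) ^ 2 - 1 = E := by rw [← hE, zpow_two_mul hq]
  have e₁ : a * b * c * q * (q ^ m * q ^ k) ^ 2 - 1 = D := by
    rw [← hD, zpow_two_mul_add hq]; norm_cast; ring
  have e₂ : a * b * c * (q * q ^ m * q ^ k) ^ 2 - 1 = E' := by
    rw [← hE', zpow_two_mul_add hq]; norm_cast; ring
  have e₃ : a * b * c * q * (q * q ^ m * q ^ k) ^ 2 - 1 = D' := by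
    rw [← hD', zpow_two_mul_add hq]; norm_cast; ring
  have e₄ : a * b * c * q * (q * q ^ m * (q ^ k / q)) ^ 2 - 1 = D := by rw [← e₁]; field_simp
  rw [cX2, h22_eq _ _ _ _ hq hX hY e₀, h22_eq _ _ _ _ hq (mul_ne_zero hq hX) hY e₂, bX1]
  simp only [g1_eq _ _ _ _ hq hX hY e₁, g2_eq _ _ _ _ hq hX hY e₁,
    g1_eq _ _ _ _ hq (mul_ne_zero hq hX) hY e₃, g2_eq _ _ _ _ hq (mul_ne_zero hq hX) hY e₃, g2_eq _ _ _ _ hq (mul_ne_zero hq hX) (div_ne_zero hY hq) e₄]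
  simp only [zpow_add₀ hq, zpow_sub₀ hq, zpow_neg, zpow_mul', zpow_one, zpow_ofNat, qNum,
    w1, w2, w11, w12, w22]
  clear hD hD' hE hE'
  generalize qPoch q q (k + 1 - 3).toNat = F at *
  clear hp
  generalize q ^ m = X at *
  generalize q ^ k = Y at *
  field_simp
  rw [← e₀, ← e₁, ← e₂, ← e₃]
  ring

theorem entryC2_sup (hq : q ≠ 0) (hq1 : q - 1 ≠ 0) (hq2 : q + 1 ≠ 0) (m k : ℤ)
    (h₀ : a * b * c * q ^ (2 * (m + k)) - 1 ≠ 0)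
    (h₁ : a * b * c * q ^ (2 * (m + k) + 1) - 1 ≠ 0)
    (h₂ : a * b * c * q ^ (2 * (m + k) + 2) - 1 ≠ 0)
    (h₃ : a * b * c * q ^ (2 * (m + k) + 3) - 1 ≠ 0)
    (hF : qPoch q q (m + k - (k + 1) - 1).toNat ≠ 0)
    (hp : qPoch q q (m + k - (k + 1) + 1).toNat
      = qPoch q q (m + k - (k + 1) - 1).toNat * ((1 - q ^ m / q) * (1 - q ^ m))) :
    entryC2 q a b c d (m + k) (k + 1) (k + 2) = cY1 q a b c d (q ^ m) (q ^ k) := by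
  have hX : q ^ m ≠ 0 := zpow_ne_zero _ hq
  have hY : q ^ k ≠ 0 := zpow_ne_zero _ hq
  obtain ⟨E, hE⟩ : ∃ D, a * b * c * q ^ (2 * (m + k)) - 1 = D := ⟨_, rfl⟩
  obtain ⟨D, hD⟩ : ∃ D, a * b * c * q ^ (2 * (m + k) + 1) - 1 = D := ⟨_, rfl⟩
  obtain ⟨E', hE'⟩ : ∃ D, a * b * c * q ^ (2 * (m + k) + 2) - 1 = D := ⟨_, rfl⟩
  obtain ⟨D', hD'⟩ : ∃ D, a * b * c * q ^ (2 * (m + k) + 3) - 1 = D := ⟨_, rfl⟩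
  rw [entryC2, if_neg (by omega), if_neg (by omega), if_pos (by omega), denC, hp, hD, hE, hE']
  rw [hE] at h₀
  rw [hD] at h₁
  rw [hE'] at h₂
  rw [hD'] at h₃
  have e₀ : a * b * c * (q ^ m * q ^ k) ^ 2 - 1 = E := by rw [← hE, zpow_two_mul hq]
  have e₁ : a * b * c * q * (q ^ m * q ^ k) ^ 2 - 1 = D := by
    rw [← hD, zpow_two_mul_add hq]; norm_cast; ring
  have e₂ : a * b * c * (q ^ m * (q * q ^ k)) ^ 2 - 1 = E' := by
    rw [← hE', zpow_two_mul_add hq]; norm_cast; ring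
  have e₃ : a * b * c * q * (q ^ m * (q * q ^ k)) ^ 2 - 1 = D' := by
    rw [← hD', zpow_two_mul_add hq]; norm_cast; ring
  have e₄ : a * b * c * q * (q ^ m / q * (q * q ^ k)) ^ 2 - 1 = D := by rw [← e₁]; field_simp
  rw [cY1, h11_eq _ _ _ _ hq hX hY e₀, h11_eq _ _ _ _ hq hX (mul_ne_zero hq hY) e₂, bY1]
  simp only [g1_eq _ _ _ _ hq hX hY e₁, g2_eq _ _ _ _ hq hX hY e₁,
    g1_eq _ _ _ _ hq hX (mul_ne_zero hq hY) e₃, g2_eq _ _ _ _ hq hX (mul_ne_zero hq hY) e₃, g1_eq _ _ _ _ hq (div_ne_zero hX hq) (mul_ne_zero hq hY) e₄]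
  simp only [zpow_add₀ hq, zpow_sub₀ hq, zpow_neg, zpow_mul', zpow_one, zpow_ofNat, qNum,
    w1, w2, w11, w12, w22]
  clear hD hD' hE hE'
  generalize qPoch q q (m + k - (k + 1) - 1).toNat = F at *
  clear hp
  generalize q ^ m = X at *
  generalize q ^ k = Y at *
  field_simp
  rw [← e₀, ← e₁, ← e₂, ← e₃]
  ring

end Coefficients

/-! ### Eigenvectors of the polynomial operator -/

/-- The total degree is less than `N`. -/
def DegLT (p : MvPolynomial (Fin 2) ℝ) (N : ℕ) : Prop := ∀ m k, N ≤ m + k → cf p m k = 0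

theorem DegLT.eq_zero {p : MvPolynomial (Fin 2) ℝ} (h : DegLT p 0) : p = 0 :=
  cf_ext fun m k => by rw [h m k (Nat.zero_le _), cf_zero]

theorem DegLT.sub {p r : MvPolynomial (Fin 2) ℝ} {N : ℕ} (hp : DegLT p N) (hr : DegLT r N) :
    DegLT (p - r) N := fun m k h => by rw [cf_sub, hp m k h, hr m k h, sub_zero]

section Eigenvectors

variable (q a b c d : ℝ)

/-- The operator minus its eigenvalue on the solutions of degree `j`. -/
def sOp (j : ℕ) : MvPolynomial (Fin 2) ℝ →ₗ[ℝ] MvPolynomial (Fin 2) ℝ :=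
  mPoly q a b c d - mEig q a b c (q ^ j) • LinearMap.id

theorem sOp_apply (j : ℕ) (p : MvPolynomial (Fin 2) ℝ) :
    sOp q a b c d j p = mPoly q a b c d p - mEig q a b c (q ^ j) • p := rfl

theorem sOp_eq_zero_iff (j : ℕ) (p : MvPolynomial (Fin 2) ℝ) :
    sOp q a b c d j p = 0 ↔ mPoly q a b c d p = mEig q a b c (q ^ j) • p := by
  rw [sOp_apply, sub_eq_zero]

variable {q}

/-- The operator is triangular for the total degree: a coefficient of the image involves only
coefficients of the same monomial and of monomials of higher degree. -/
theorem cf_sOp_of_degLT (hq : q ≠ 0) {p : MvPolynomial (Fin 2) ℝ} {N : ℕ} (hp : DegLT p (N + 1))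
    (j : ℕ) {m k : ℕ} (h : N ≤ m + k) :
    cf (sOp q a b c d j p) m k
      = (mEig q a b c (q ^ (m + k)) - mEig q a b c (q ^ j)) * cf p m k := by
  rw [sOp_apply, cf_sub, cf_smul, cf_mPoly a b c d hq, hp (m + 1) k (by omega),
    hp m (k + 1) (by omega), hp (m + 2) k (by omega), hp (m + 1) (k + 1) (by omega),
    hp m (k + 2) (by omega)]
  ring

theorem degLT_sOp (hq : q ≠ 0) {p : MvPolynomial (Fin 2) ℝ} {N : ℕ} (hp : DegLT p N) (j : ℕ) :
    DegLT (sOp q a b c d j p) N := by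
  intro m k h
  rw [cf_sOp_of_degLT a b c d hq (fun m' k' h' => hp m' k' (by omega)) j h, hp m k h, mul_zero]

theorem degLT_sOp_self (hq : q ≠ 0) {p : MvPolynomial (Fin 2) ℝ} {j : ℕ} (hp : DegLT p (j + 1)) :
    DegLT (sOp q a b c d j p) j := by
  intro m k h
  rw [cf_sOp_of_degLT a b c d hq hp j h]
  rcases h.eq_or_lt with h | h
  · rw [← h, sub_self, zero_mul]
  · rw [hp m k h, mul_zero]

variable {a b c}

/-- The eigenvalues of solutions of different degrees are different. -/
theorem mEig_ne (hq0 : 0 < q) (hq1 : q < 1) (hs : ∀ N, 3 ≤ N → a * b * c * q ^ N ≠ 1) {i j : ℕ}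
    (h : i ≠ j) : mEig q a b c (q ^ i) - mEig q a b c (q ^ j) ≠ 0 := by
  have hq := hq0.ne'
  have e : mEig q a b c (q ^ i) - mEig q a b c (q ^ j)
      = (q ^ i - q ^ j) * (a * b * c * q ^ (i + j + 2) - 1) / q ^ (i + j) := by
    rw [mEig, mEig]
    simp only [pow_add]
    field_simp
    ring
  rw [e]
  refine div_ne_zero (mul_ne_zero ?_ (sub_ne_zero.2 (hs _ (by omega)))) (pow_ne_zero _ hq)
  exact sub_ne_zero.2 fun h' => h (pow_right_injective₀ hq0 hq1.ne h')

/-- All degrees present are below `N ≤ j`, so their eigenvalues differ from that of degree `j`, and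
the top part is stripped off repeatedly. -/
theorem eq_zero_of_sOp (hq0 : 0 < q) (hq1 : q < 1) (hs : ∀ N, 3 ≤ N → a * b * c * q ^ N ≠ 1)
    {j N : ℕ} (hN : N ≤ j) {p : MvPolynomial (Fin 2) ℝ} (hp : DegLT p N)
    (h : sOp q a b c d j p = 0) : p = 0 := by
  induction N with
  | zero => exact hp.eq_zero
  | succ N ih =>
    refine ih (by omega) fun m k hmk => ?_
    rcases hmk.eq_or_lt with e | e
    · have h₁ := cf_sOp_of_degLT a b c d hq0.ne' hp j hmk
      rw [h, cf_zero, eq_comm, mul_eq_zero] at h₁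
      exact h₁.resolve_left (mEig_ne hq0 hq1 hs (by omega))
    · exact hp m k e

theorem exists_sOp_eq (hq0 : 0 < q) (hq1 : q < 1) (hs : ∀ N, 3 ≤ N → a * b * c * q ^ N ≠ 1)
    {j N : ℕ} (hN : N ≤ j) {r : MvPolynomial (Fin 2) ℝ} (hr : DegLT r N) :
    ∃ p, DegLT p N ∧ sOp q a b c d j p = r := by
  induction N generalizing r with
  | zero => exact ⟨0, fun m k _ => cf_zero m k, by rw [map_zero, hr.eq_zero]⟩
  | succ N ih =>
    have hne := mEig_ne (q := q) (i := N) (j := j) hq0 hq1 hs (by omega)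
    set t := (mEig q a b c (q ^ N) - mEig q a b c (q ^ j))⁻¹ with ht
    -- The multiple `t • r` solves the equation in degree `N`; the error has lower degree and is
    -- left to the induction.
    obtain ⟨p, hp, hp'⟩ := ih (by omega) (r := r - t • sOp q a b c d j r) (by
      intro m k h
      rw [cf_sub, cf_smul, cf_sOp_of_degLT a b c d hq0.ne' hr j h]
      rcases h.eq_or_lt with e | e
      · rw [← e, ht, inv_mul_cancel_left₀ hne, sub_self]
      · rw [hr m k e]; ring)
    refine ⟨t • r + p, fun m k h => ?_, ?_⟩
    · rw [cf_add, cf_smul, hr m k h, hp m k (by omega)]; ring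
    · rw [map_add, map_smul, hp']; abel

/-- The operator `sOp` at the degree of the monomial cancels its top term, so its image has lower
degree and can be removed by a correction of lower degree. -/
theorem exists_monic_eigenvector (hq0 : 0 < q) (hq1 : q < 1)
    (hs : ∀ N, 3 ≤ N → a * b * c * q ^ N ≠ 1) (m k : ℕ) :
    ∃ p, DegLT (p - mono m k) (m + k) ∧ sOp q a b c d (m + k) p = 0 := by
  have h₀ : DegLT (mono m k) (m + k + 1) := fun m' k' h => by
    rw [cf_mono, if_neg (by omega)]
  obtain ⟨p, hp, hp'⟩ := exists_sOp_eq d hq0 hq1 hs le_rfl (degLT_sOp_self a b c d hq0.ne' h₀)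
  refine ⟨mono m k - p, fun m' k' h => ?_, by rw [map_sub, hp', sub_self]⟩
  rw [cf_sub, cf_sub, hp m' k' h]
  ring

/-- The data of a monic eigenvector with leading monomial `x^m y^k`. -/
structure IsMonicEigen (q a b c d : ℝ) (m k : ℕ) (p : MvPolynomial (Fin 2) ℝ) : Prop where
  degLT : DegLT (p - mono m k) (m + k)
  sOp_eq : sOp q a b c d (m + k) p = 0

namespace IsMonicEigen

variable {d} {m₀ k₀ : ℕ} {p : MvPolynomial (Fin 2) ℝ}

theorem eq (hq0 : 0 < q) (hq1 : q < 1) (hs : ∀ N, 3 ≤ N → a * b * c * q ^ N ≠ 1)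
    {r : MvPolynomial (Fin 2) ℝ} (hp : IsMonicEigen q a b c d m₀ k₀ p)
    (hr : IsMonicEigen q a b c d m₀ k₀ r) : p = r := by
  refine sub_eq_zero.1 (eq_zero_of_sOp d hq0 hq1 hs (le_refl (m₀ + k₀)) (p := p - r) ?_ ?_)
  · have h := hp.degLT.sub hr.degLT
    rwa [sub_sub_sub_cancel_right] at h
  · rw [map_sub, hp.sOp_eq, hr.sOp_eq, sub_self]

theorem cf_top (hp : IsMonicEigen q a b c d m₀ k₀ p) {m k : ℕ} (h : m₀ + k₀ ≤ m + k) :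
    cf p m k = if m = m₀ ∧ k = k₀ then 1 else 0 := by
  have h₁ := hp.degLT m k h
  rw [cf_sub, cf_mono, sub_eq_zero] at h₁
  exact h₁

theorem cf_eigen (hq : q ≠ 0) (hp : IsMonicEigen q a b c d m₀ k₀ p) (m k : ℕ) :
    (mEig q a b c (q ^ (m₀ + k₀)) - mEig q a b c (q ^ (m + k))) * cf p m k =
      w1 q a b c d (q ^ (m + 1)) (q ^ k) * cf p (m + 1) k
      + w2 q a b c d (q ^ m) (q ^ (k + 1)) * cf p m (k + 1)
      + w11 q a c d (q ^ (m + 2)) * cf p (m + 2) k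
      + w12 q a c d (q ^ (m + 1)) (q ^ (k + 1)) * cf p (m + 1) (k + 1)
      + w22 q a d (q ^ (k + 2)) * cf p m (k + 2) := by
  have h := congrArg (fun r => cf r m k) hp.sOp_eq
  simp only [sOp_apply, cf_sub, cf_smul, cf_zero, cf_mPoly a b c d hq] at h
  linear_combination -h

/-- One degree below the top, the eigenvalue equation involves only the leading coefficient besides
the unknown, and the nonzero eigenvalue gap is divided out. `cf_sub_two` repeats this one degree
lower. -/
theorem cf_sub_one (hq0 : 0 < q) (hq1 : q < 1) (hs : ∀ N, 3 ≤ N → a * b * c * q ^ N ≠ 1)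
    (hp : IsMonicEigen q a b c d m₀ k₀ p) {m k : ℕ} (h : m + k + 1 = m₀ + k₀) :
    cf p m k = (if k = k₀ then g1 q a b c d (q ^ m₀) (q ^ k₀) else 0)
      + (if k + 1 = k₀ then g2 q a b c d (q ^ m₀) (q ^ k₀) else 0) := by
  have hq := hq0.ne'
  have hne := mEig_ne (q := q) (i := m₀ + k₀) (j := m + k) hq0 hq1 hs (by omega)
  have e := hp.cf_eigen hq m k
  rw [hp.cf_top (m := m + 1) (k := k) (by omega), hp.cf_top (m := m) (k := k + 1) (by omega),
    hp.cf_top (m := m + 2) (k := k) (by omega), hp.cf_top (m := m + 1) (k := k + 1) (by omega),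
    hp.cf_top (m := m) (k := k + 2) (by omega), if_neg (show ¬(m + 2 = m₀ ∧ k = k₀) by omega),
    if_neg (show ¬(m + 1 = m₀ ∧ k + 1 = k₀) by omega),
    if_neg (show ¬(m = m₀ ∧ k + 2 = k₀) by omega)] at e
  have hpow : q ^ m₀ * q ^ k₀ / q = q ^ (m + k) := by
    rw [← pow_add, ← h, pow_succ, mul_div_cancel_right₀ _ hq]
  rw [g1, g2, hpow, ← pow_add]
  rw [← mul_right_inj' hne, e]
  rcases eq_or_ne k k₀ with h₁ | h₁
  · obtain rfl : m + 1 = m₀ := by omega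
    subst h₁
    simp only [and_self, if_true, Nat.succ_ne_self, if_false, and_false]
    field_simp
    ring
  · rcases eq_or_ne (k + 1) k₀ with h₂ | h₂
    · obtain rfl : m = m₀ := by omega
      subst h₂
      simp only [and_self, if_true, h₁, if_false, and_false]
      field_simp
      ring
    · simp [h₁, h₂]

theorem cf_sub_two (hq0 : 0 < q) (hq1 : q < 1) (hs : ∀ N, 3 ≤ N → a * b * c * q ^ N ≠ 1)
    (hp : IsMonicEigen q a b c d m₀ k₀ p) {m k : ℕ} (h : m + k + 2 = m₀ + k₀) :
    cf p m k = (if k = k₀ then h11 q a b c d (q ^ m₀) (q ^ k₀) else 0)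
      + (if k + 1 = k₀ then h12 q a b c d (q ^ m₀) (q ^ k₀) else 0)
      + (if k + 2 = k₀ then h22 q a b c d (q ^ m₀) (q ^ k₀) else 0) := by
  have hq := hq0.ne'
  have hne := mEig_ne (q := q) (i := m₀ + k₀) (j := m + k) hq0 hq1 hs (by omega)
  have e := hp.cf_eigen hq m k
  rw [hp.cf_sub_one hq0 hq1 hs (m := m + 1) (k := k) (by omega),
    hp.cf_sub_one hq0 hq1 hs (m := m) (k := k + 1) (by omega),
    hp.cf_top (m := m + 2) (k := k) (by omega), hp.cf_top (m := m + 1) (k := k + 1) (by omega),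
    hp.cf_top (m := m) (k := k + 2) (by omega)] at e
  have hpow : q ^ m₀ * q ^ k₀ / q ^ 2 = q ^ (m + k) := by
    rw [← pow_add, ← h, pow_add, mul_div_cancel_right₀ _ (pow_ne_zero 2 hq)]
  rw [h11, h12, h22, hpow, ← pow_add]
  rw [← mul_right_inj' hne, e]
  rcases eq_or_ne k k₀ with h₁ | h₁
  · obtain rfl : m + 2 = m₀ := by omega
    subst h₁
    have e₁ : q ^ (m + 2) / q = q ^ (m + 1) := by rw [pow_succ q (m + 1)]; field_simp
    rw [e₁]
    have : ¬ (k + 1 + 1 = k) := by omega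
    simp only [and_self, if_true, Nat.succ_ne_self, if_false, and_false, this, false_and,
      Nat.add_eq_left, OfNat.ofNat_ne_zero]
    field_simp
    ring
  · rcases eq_or_ne (k + 1) k₀ with h₂ | h₂
    · obtain rfl : m + 1 = m₀ := by omega
      subst h₂
      have e₁ : q ^ (m + 1) / q = q ^ m := by rw [pow_succ]; field_simp
      have e₂ : q ^ (k + 1) / q = q ^ k := by rw [pow_succ]; field_simp
      rw [e₁, e₂]
      have : ¬ (k + 2 = k + 1) := by omega
      simp only [and_self, if_true, h₁, if_false, and_false, this, false_and, Nat.succ_ne_self]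
      field_simp
      ring
    · rcases eq_or_ne (k + 2) k₀ with h₃ | h₃
      · obtain rfl : m = m₀ := by omega
        subst h₃
        have e₂ : q ^ (k + 2) / q = q ^ (k + 1) := by rw [pow_succ q (k + 1)]; field_simp
        rw [e₂]
        simp only [and_self, if_true, h₁, h₂, if_false, and_false, false_and]
        field_simp
        ring
      · simp [h₁, h₂, h₃, show ¬ (k + 1 + 1 = k₀) from h₃]

end IsMonicEigen

end Eigenvectors

/-! ### The three-term recurrence relations -/

section Recurrence

variable {q a b c d : ℝ}

namespace IsMonicEigen

variable {m₀ k₀ : ℕ} {p : MvPolynomial (Fin 2) ℝ}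

theorem cf_X_zero_mul_top (hp : IsMonicEigen q a b c d m₀ k₀ p) {m k : ℕ}
    (h : m₀ + k₀ + 1 ≤ m + k) :
    cf (MvPolynomial.X 0 * p) m k = if m = m₀ + 1 ∧ k = k₀ then 1 else 0 := by
  rw [cf_X_zero_mul]
  rcases m with _ | m
  · rw [if_pos rfl, if_neg (by omega)]
  · rw [if_neg m.succ_ne_zero, Nat.add_sub_cancel, hp.cf_top (by omega)]
    simp only [Nat.add_right_cancel_iff]

theorem cf_X_one_mul_top (hp : IsMonicEigen q a b c d m₀ k₀ p) {m k : ℕ}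
    (h : m₀ + k₀ + 1 ≤ m + k) :
    cf (MvPolynomial.X 1 * p) m k = if m = m₀ ∧ k = k₀ + 1 then 1 else 0 := by
  rw [cf_X_one_mul]
  rcases k with _ | k
  · rw [if_pos rfl, if_neg (by omega)]
  · rw [if_neg k.succ_ne_zero, Nat.add_sub_cancel, hp.cf_top (by omega)]
    simp only [Nat.add_right_cancel_iff]

variable (hq0 : 0 < q) (hq1 : q < 1) (hs : ∀ N, 3 ≤ N → a * b * c * q ^ N ≠ 1)
include hq0 hq1 hs

theorem cf_X_zero_mul_sub_one (hp : IsMonicEigen q a b c d m₀ k₀ p) {m k : ℕ}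
    (h : m + k = m₀ + k₀) :
    cf (MvPolynomial.X 0 * p) m k = (if k = k₀ then g1 q a b c d (q ^ m₀) (q ^ k₀) else 0)
      + (if k + 1 = k₀ then g2 q a b c d (q ^ m₀) (q ^ k₀) else 0) := by
  rw [cf_X_zero_mul]
  rcases m with _ | m
  · rw [if_pos rfl, if_neg (show ¬ k + 1 = k₀ by omega)]
    split_ifs with h₁
    · obtain rfl : m₀ = 0 := by omega
      -- For `m₀ = 0` the product has no such coefficient, and `g1` vanishes at `X = 1`.
      simp [g1, w1]
    · simp
  · rw [if_neg m.succ_ne_zero, Nat.add_sub_cancel, hp.cf_sub_one hq0 hq1 hs (by omega)]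

theorem cf_X_one_mul_sub_one (hp : IsMonicEigen q a b c d m₀ k₀ p) {m k : ℕ}
    (h : m + k = m₀ + k₀) :
    cf (MvPolynomial.X 1 * p) m k = (if k = k₀ + 1 then g1 q a b c d (q ^ m₀) (q ^ k₀) else 0)
      + (if k = k₀ then g2 q a b c d (q ^ m₀) (q ^ k₀) else 0) := by
  rw [cf_X_one_mul]
  rcases k with _ | k
  · rw [if_pos rfl, if_neg (show ¬ 0 = k₀ + 1 by omega)]
    split_ifs with h₁
    · subst h₁
      simp [g2, w2]
    · simp
  · rw [if_neg k.succ_ne_zero, Nat.add_sub_cancel, hp.cf_sub_one hq0 hq1 hs (by omega)]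
    simp only [Nat.add_right_cancel_iff]

theorem cf_X_zero_mul_sub_two (hp : IsMonicEigen q a b c d m₀ k₀ p) {m k : ℕ}
    (h : m + k + 1 = m₀ + k₀) :
    cf (MvPolynomial.X 0 * p) m k = (if k = k₀ then h11 q a b c d (q ^ m₀) (q ^ k₀) else 0)
      + (if k + 1 = k₀ then h12 q a b c d (q ^ m₀) (q ^ k₀) else 0)
      + (if k + 2 = k₀ then h22 q a b c d (q ^ m₀) (q ^ k₀) else 0) := by
  rw [cf_X_zero_mul]
  rcases m with _ | m
  · rw [if_pos rfl, if_neg (show ¬ k + 2 = k₀ by omega)]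
    split_ifs with h₁ h₂ h₂
    · omega
    · obtain rfl : m₀ = 1 := by omega
      -- At `X = q` both terms of the numerator of `h11` vanish: the factor `X - q` of `w11`, and
      -- `w1` at `X / q = 1`.
      simp [h11, w11, w1, hq0.ne']
    · obtain rfl : m₀ = 0 := by omega
      simp [h12, w12, w1, g1]
    · simp
  · rw [if_neg m.succ_ne_zero, Nat.add_sub_cancel, hp.cf_sub_two hq0 hq1 hs (by omega)]

theorem cf_X_one_mul_sub_two (hp : IsMonicEigen q a b c d m₀ k₀ p) {m k : ℕ}
    (h : m + k + 1 = m₀ + k₀) :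
    cf (MvPolynomial.X 1 * p) m k = (if k = k₀ + 1 then h11 q a b c d (q ^ m₀) (q ^ k₀) else 0)
      + (if k = k₀ then h12 q a b c d (q ^ m₀) (q ^ k₀) else 0)
      + (if k + 1 = k₀ then h22 q a b c d (q ^ m₀) (q ^ k₀) else 0) := by
  rw [cf_X_one_mul]
  rcases k with _ | k
  · rw [if_pos rfl, if_neg (show ¬ 0 = k₀ + 1 by omega)]
    split_ifs with h₁ h₂ h₂
    · omega
    · subst h₁
      simp [h12, w12, w2, g2]
    · obtain rfl : k₀ = 1 := by omega
      simp [h22, w22, w2, hq0.ne']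
    · simp
  · rw [if_neg k.succ_ne_zero, Nat.add_sub_cancel, hp.cf_sub_two hq0 hq1 hs (by omega)]
    simp only [Nat.add_right_cancel_iff]

end IsMonicEigen

variable (q a b c d) in
/-- The entries of `B_{n,v+1}`, with rows and columns numbered from `0`. -/
def bEntry (v : Fin 2) (n k l : ℕ) : ℝ :=
  if v = 0 then
    if l = k then bX0 q a b c d (q ^ (n - k)) (q ^ k)
    else if l + 1 = k then bX1 q a b c d (q ^ (n - k)) (q ^ k) else 0
  else
    if l = k then bY0 q a b c d (q ^ (n - k)) (q ^ k)
    else if l = k + 1 then bY1 q a b c d (q ^ (n - k)) (q ^ k) else 0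

variable (q a b c d) in
/-- The entries of `C_{n,v+1}`, with rows and columns numbered from `0`. -/
def cEntry (v : Fin 2) (n k l : ℕ) : ℝ :=
  if v = 0 then
    if l = k then cX0 q a b c d (q ^ (n - k)) (q ^ k)
    else if l + 1 = k then cX1 q a b c d (q ^ (n - k)) (q ^ k)
    else if l + 2 = k then cX2 q a b c d (q ^ (n - k)) (q ^ k) else 0
  else
    if l = k then cY0 q a b c d (q ^ (n - k)) (q ^ k)
    else if l = k + 1 then cY1 q a b c d (q ^ (n - k)) (q ^ k)
    else if l + 1 = k then cY2 q a b c d (q ^ (n - k)) (q ^ k) else 0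

variable (q a b c d) in
/-- All entries are monic eigenvectors. -/
def IsEigenFamily (P : PolyVecFamily) : Prop :=
  ∀ (n : ℕ) (k : Fin (n + 1)), IsMonicEigen q a b c d (n - k) k (P n k)

namespace IsEigenFamily

variable {P : PolyVecFamily} (hP : IsEigenFamily q a b c d P)
include hP

theorem cf_sum_top {n : ℕ} (t : ℕ → ℝ) {m l : ℕ} (h : n ≤ m + l) :
    cf (∑ i : Fin (n + 1), t i • P n i) m l = if m + l = n then t l else 0 := by
  simp only [cf_sum, cf_smul]
  split_ifs with h'
  · rw [Finset.sum_eq_single (⟨l, by omega⟩ : Fin (n + 1))]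
    · rw [(hP n _).cf_top (by simp only; omega), if_pos ⟨by simp only; omega, rfl⟩, mul_one]
    · intro i _ hi
      rw [(hP n i).cf_top (by omega), if_neg (fun h => hi (Fin.ext h.2.symm)), mul_zero]
    · exact fun h => absurd (Finset.mem_univ _) h
  · refine Finset.sum_eq_zero fun i _ => ?_
    rw [(hP n i).cf_top (by omega), if_neg (by omega), mul_zero]

theorem cf_sum_prevVec_top {n : ℕ} (t : ℕ → ℝ) {m l : ℕ} (h : n ≤ m + l + 1) :
    cf (∑ i : Fin n, t i • prevVec P n i) m l = if m + l + 1 = n then t l else 0 := by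
  rcases n with _ | n
  · simp [cf_zero]
  · have h₁ := hP.cf_sum_top t (n := n) (m := m) (l := l) (by omega)
    simp only [Nat.add_right_cancel_iff]
    exact h₁

theorem cf_sum_sub_one (hq0 : 0 < q) (hq1 : q < 1) (hs : ∀ N, 3 ≤ N → a * b * c * q ^ N ≠ 1)
    {n : ℕ} (t : ℕ → ℝ) {m l : ℕ} (h : m + l + 1 = n) :
    cf (∑ i : Fin (n + 1), t i • P n i) m l = t l * g1 q a b c d (q ^ (n - l)) (q ^ l)
      + t (l + 1) * g2 q a b c d (q ^ (n - (l + 1))) (q ^ (l + 1)) := by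
  have h₁ (i : Fin (n + 1)) : cf (t i • P n i) m l
      = (fun i : ℕ => t i * ((if l = i then g1 q a b c d (q ^ (n - i)) (q ^ i) else 0)
        + (if l + 1 = i then g2 q a b c d (q ^ (n - i)) (q ^ i) else 0))) i := by
    rw [cf_smul, (hP n i).cf_sub_one hq0 hq1 hs (by omega)]
  rw [cf_sum, Finset.sum_congr rfl fun i _ => h₁ i,
    Fin.sum_univ_eq_sum_range (fun i : ℕ => t i *
      ((if l = i then g1 q a b c d (q ^ (n - i)) (q ^ i) else 0)
        + (if l + 1 = i then g2 q a b c d (q ^ (n - i)) (q ^ i) else 0)))]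
  simp only [mul_add, Finset.sum_add_distrib, mul_ite, mul_zero]
  rw [Finset.sum_ite_eq, Finset.sum_ite_eq, if_pos (by simp; omega), if_pos (by simp; omega)]

theorem recurrence (hq0 : 0 < q) (hq1 : q < 1) (hs : ∀ N, 3 ≤ N → a * b * c * q ^ N ≠ 1)
    (ha : a ≠ 0) (hc : c ≠ 0) (hd : d ≠ 0) (v : Fin 2) (n : ℕ) (k : Fin (n + 1)) :
    MvPolynomial.X v * P n k = P (n + 1) ⟨k + v, by omega⟩
      + ∑ l : Fin (n + 1), bEntry q a b c d v n k l • P n l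
      + ∑ l : Fin n, cEntry q a b c d v n k l • prevVec P n l := by
  have hq := hq0.ne'
  set r := MvPolynomial.X v * P n k - P (n + 1) ⟨k + v, by omega⟩
      - ∑ l : Fin (n + 1), bEntry q a b c d v n k l • P n l
      - ∑ l : Fin n, cEntry q a b c d v n k l • prevVec P n l with hr
  -- The entries `bEntry` and `cEntry` are defined so that the remainder has no terms of degree `n`
  -- and `n - 1`; degree `n + 1` cancels because the polynomials are monic.
  have hdeg : ∀ m l, n ≤ m + l + 1 → cf r m l = 0 := by
    intro m l h
    rw [hr, cf_sub, cf_sub, cf_sub, hP.cf_sum_prevVec_top _ h]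
    have hk := k.2
    rcases (show n + 1 ≤ m + l ∨ m + l = n ∨ m + l + 1 = n by omega) with h₁ | h₁ | h₁
    · rw [hP.cf_sum_top _ (by omega), if_neg (by omega), if_neg (by omega),
        (hP _ _).cf_top (by simp only; omega)]
      fin_cases v
      · rw [show (⟨0, by omega⟩ : Fin 2) = 0 from rfl, (hP n k).cf_X_zero_mul_top (by omega)]
        simp [show n + 1 - (k : ℕ) = n - k + 1 by omega]
      · rw [show (⟨1, by omega⟩ : Fin 2) = 1 from rfl, (hP n k).cf_X_one_mul_top (by omega)]
        simp
    · rw [hP.cf_sum_top _ (by omega), if_pos h₁, if_neg (by omega),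
        (hP _ _).cf_sub_one hq0 hq1 hs (by simp only; omega)]
      fin_cases v
      · rw [show (⟨0, by omega⟩ : Fin 2) = 0 from rfl,
          (hP n k).cf_X_zero_mul_sub_one hq0 hq1 hs (by omega)]
        simp only [bEntry, if_true, Fin.val_zero, add_zero]
        rw [show n + 1 - (k : ℕ) = n - k + 1 by omega, pow_succ' q (n - k), bX0, bX1]
        by_cases h₂ : l = k
        · simp [h₂]
        · by_cases h₃ : l + 1 = k <;> simp [h₂, h₃]
      · rw [show (⟨1, by omega⟩ : Fin 2) = 1 from rfl,
          (hP n k).cf_X_one_mul_sub_one hq0 hq1 hs (by omega)]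
        simp only [bEntry, one_ne_zero, if_false, Fin.val_one, Nat.add_right_cancel_iff]
        rw [show n + 1 - ((k : ℕ) + 1) = n - k by omega, pow_succ' q k, bY0, bY1]
        by_cases h₂ : l = k
        · simp [h₂]
        · by_cases h₃ : l = k + 1 <;> simp [h₂, h₃]
    · rw [hP.cf_sum_sub_one hq0 hq1 hs _ h₁, if_pos h₁,
        (hP _ _).cf_sub_two hq0 hq1 hs (by simp only; omega)]
      fin_cases v
      · rw [show (⟨0, by omega⟩ : Fin 2) = 0 from rfl,
          (hP n k).cf_X_zero_mul_sub_two hq0 hq1 hs (by omega)]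
        simp only [bEntry, cEntry, if_true, Fin.val_zero, add_zero]
        rw [show n + 1 - (k : ℕ) = n - k + 1 by omega, pow_succ' q (n - k)]
        rcases eq_or_ne l k with h₂ | h₂
        · subst h₂
          simp [cX0, show ¬ (k : ℕ) + 1 + 1 = k by omega]
        · rcases eq_or_ne (l + 1) k with h₃ | h₃
          · have e₁ : q ^ (n - l) = q * q ^ (n - (l + 1)) := by rw [← pow_succ']; congr 1; omega
            have e₂ : q ^ (l + 1) / q = q ^ l := by rw [pow_succ]; field_simp
            rw [← h₃, cX1, e₁, e₂]
            simp
            ring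
          · rcases eq_or_ne (l + 2) k with h₄ | h₄
            · have e₁ : q ^ (n - (l + 1)) = q * q ^ (n - (l + 2)) := by
                rw [← pow_succ']; congr 1; omega
              have e₂ : q ^ (l + 2) / q = q ^ (l + 1) := by rw [pow_succ q (l + 1)]; field_simp
              rw [← h₄, cX2, e₁, e₂]
              simp
            · simp [h₂, h₃, h₄, show ¬ l + 1 + 1 = k from h₄]
      · rw [show (⟨1, by omega⟩ : Fin 2) = 1 from rfl,
          (hP n k).cf_X_one_mul_sub_two hq0 hq1 hs (by omega)]
        simp only [bEntry, cEntry, one_ne_zero, if_false, Fin.val_one, Nat.add_right_cancel_iff]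
        rw [show n + 1 - ((k : ℕ) + 1) = n - k by omega, pow_succ' q k]
        rcases eq_or_ne l k with h₂ | h₂
        · subst h₂
          have e₁ : q ^ (n - (k : ℕ)) / q = q ^ (n - ((k : ℕ) + 1)) := by
            rw [show n - (k : ℕ) = n - (k + 1) + 1 by omega, pow_succ]; field_simp
          rw [cY0, e₁, ← pow_succ']
          simp
          ring
        · rcases eq_or_ne (l + 1) k with h₃ | h₃
          · rw [← h₃, cY2]
            simp [show ¬ l = l + 1 + 1 by omega]
          · rcases eq_or_ne l (k + 1) with h₄ | h₄
            · have e₁ : q ^ (n - (k : ℕ)) / q = q ^ (n - ((k : ℕ) + 1)) := by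
                rw [show n - (k : ℕ) = n - (k + 1) + 1 by omega, pow_succ]; field_simp
              rw [h₄, cY1, e₁, ← pow_succ']
              simp [show ¬ (k : ℕ) + 1 + 1 = k by omega]
            · simp [h₂, h₃, h₄]
  suffices h : r = 0 by
    rw [hr, sub_eq_zero, sub_eq_iff_eq_add, sub_eq_iff_eq_add] at h
    rw [h]; abel
  rcases n with _ | n
  -- For `n = 0` the bound in `hdeg` is vacuous, so all coefficients are covered.
  · exact DegLT.eq_zero fun m l _ => hdeg m l (by omega)
  · have hdeg₀ : DegLT r n := fun m l h => hdeg m l (by omega)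
    have hdeg₁ := degLT_sOp a b c d hq hdeg₀ (n + 1)
    have hdeg₂ := degLT_sOp a b c d hq hdeg₁ (n + 2)
    -- The remainder has degree below `n`, so the operators for degrees `n + 1`, `n + 2` and `n` are
    -- injective on it. It remains to see that their product kills each term of `r`: the product
    -- with the coordinate by `X_mul_eigenvector`, each other term by one of the factors.
    refine eq_zero_of_sOp d hq0 hq1 hs (j := n + 1) (by omega) hdeg₀ ?_
    refine eq_zero_of_sOp d hq0 hq1 hs (j := n + 2) (by omega) hdeg₁ ?_
    refine eq_zero_of_sOp d hq0 hq1 hs (j := n) le_rfl hdeg₂ ?_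
    have hz (j : ℕ) (i : Fin (j + 1)) : mPoly q a b c d (P j i) = mEig q a b c (q ^ j) • P j i := by
      have h := (hP j i).sOp_eq
      rwa [sOp_eq_zero_iff, Nat.sub_add_cancel (by omega)] at h
    have h₁ : sOp q a b c d n (sOp q a b c d (n + 2) (sOp q a b c d (n + 1)
        (MvPolynomial.X v * P (n + 1) k))) = 0 :=
      X_mul_eigenvector a b c d hq hd ha hc v n (hz (n + 1) k)
    have hsm (i j : ℕ) (l : Fin (j + 1)) : sOp q a b c d i (P j l)
        = (mEig q a b c (q ^ j) - mEig q a b c (q ^ i)) • P j l := by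
      rw [sOp_apply, hz, sub_smul]
    have hz₁ (l : Fin (n + 1 + 1)) : sOp q a b c d n (sOp q a b c d (n + 2)
        (sOp q a b c d (n + 1) (P (n + 1) l))) = 0 := by
      rw [hsm, sub_self, zero_smul, map_zero, map_zero]
    have hz₂ (l : Fin (n + 2 + 1)) : sOp q a b c d n (sOp q a b c d (n + 2)
        (sOp q a b c d (n + 1) (P (n + 2) l))) = 0 := by
      rw [hsm, map_smul, hsm, sub_self, zero_smul, smul_zero, map_zero]
    have hz₃ (l : Fin (n + 1)) : sOp q a b c d n (sOp q a b c d (n + 2)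
        (sOp q a b c d (n + 1) (prevVec P (n + 1) l))) = 0 := by
      rw [prevVec, hsm, map_smul, hsm, map_smul, map_smul, hsm, sub_self, zero_smul, smul_zero,
        smul_zero]
    rw [hr]
    simp only [map_sub, map_sum, map_smul, h₁, hz₁, hz₂, hz₃, smul_zero, Finset.sum_const_zero,
      sub_zero]

end IsEigenFamily

end Recurrence

/-! ### Matrices acting on vectors of polynomials -/

theorem act_apply {ι κ : Type} [Fintype κ] (M : Matrix ι κ ℝ) (p : κ → MvPolynomial (Fin 2) ℝ)
    (i : ι) : act M p i = ∑ l, M i l • p l := by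
  simp only [act, Matrix.mulVec, dotProduct, Matrix.map_apply, MvPolynomial.smul_eq_C_mul]

theorem act_act {ι κ μ : Type} [Fintype κ] [Fintype μ] (M : Matrix ι κ ℝ) (N : Matrix κ μ ℝ)
    (p : μ → MvPolynomial (Fin 2) ℝ) : act M (act N p) = act (M * N) p := by
  rw [act, act, act, Matrix.mulVec_mulVec, Matrix.map_mul]

theorem act_add {ι κ : Type} [Fintype κ] (M : Matrix ι κ ℝ) (p r : κ → MvPolynomial (Fin 2) ℝ) :
    act M (p + r) = act M p + act M r := Matrix.mulVec_add ..

theorem act_one {κ : Type} [Fintype κ] [DecidableEq κ] (p : κ → MvPolynomial (Fin 2) ℝ) :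
    act (1 : Matrix κ κ ℝ) p = p := by
  rw [act, Matrix.map_one _ (map_zero _) (map_one _), Matrix.one_mulVec]

theorem act_shiftL (v : Fin 2) (n : ℕ) (p : Fin (n + 2) → MvPolynomial (Fin 2) ℝ)
    (k : Fin (n + 1)) : act (shiftL v n) p k = p ⟨k + v, by omega⟩ := by
  rw [act_apply, Finset.sum_eq_single (⟨k + v, by omega⟩ : Fin (n + 2))]
  · simp [shiftL]
  · intro l _ hl
    rw [shiftL, Matrix.of_apply, if_neg (fun h => hl (Fin.ext h)), zero_smul]
  · exact fun h => absurd (Finset.mem_univ _) h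

theorem act_joint {m l : ℕ} (M : Fin 2 → Matrix (Fin m) (Fin l) ℝ)
    (p : Fin l → MvPolynomial (Fin 2) ℝ) (r : Fin 2 × Fin m) :
    act (joint M) p r = act (M r.1) p r.2 := by
  simp only [act_apply, joint, Matrix.of_apply]

/-- Each row of the joint matrix picks one coordinate, and every coordinate is picked: the first by
the block of `x`, all others by the block of `y`. So the matrix is injective and its Gram matrix is
positive definite, hence invertible. -/
theorem Ddag_mul_joint (n : ℕ) : Ddag n * (joint fun v => shiftL v n) = 1 := by
  set J := joint fun v => shiftL v n with hJ
  have hinj : Function.Injective J.mulVec := by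
    intro x y h
    have h' (v : Fin 2) (k : Fin (n + 1)) (z : Fin (n + 2) → ℝ) :
        J.mulVec z (v, k) = z ⟨k + v, by omega⟩ := by
      rw [hJ, Matrix.mulVec, dotProduct, Finset.sum_eq_single (⟨k + v, by omega⟩ : Fin (n + 2))]
      · simp [joint, shiftL]
      · intro l _ hl
        simp only [joint, shiftL, Matrix.of_apply]
        rw [if_neg (fun h => hl (Fin.ext h)), zero_mul]
      · exact fun h => absurd (Finset.mem_univ _) h
    ext l
    by_cases hl : (l : ℕ) = 0
    · have h₁ := congrFun h (0, ⟨0, by omega⟩)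
      rw [h', h'] at h₁
      rwa [show (⟨_, _⟩ : Fin (n + 2)) = l from Fin.ext (by simp [hl])] at h₁
    · have h₁ := congrFun h (1, ⟨l - 1, by omega⟩)
      rw [h', h'] at h₁
      rwa [show (⟨_, _⟩ : Fin (n + 2)) = l from Fin.ext (by simp; omega)] at h₁
  have hpos := Matrix.PosDef.conjTranspose_mul_self J hinj
  rw [Matrix.conjTranspose_eq_transpose_of_trivial] at hpos
  rw [Ddag, Matrix.mul_assoc]
  exact Matrix.nonsing_inv_mul _ hpos.det_pos.ne'.isUnit

theorem xyKron_sub_mulVec (n : ℕ) (B : Fin 2 → Matrix (Fin (n + 1)) (Fin (n + 1)) ℝ)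
    (p : Fin (n + 1) → MvPolynomial (Fin 2) ℝ) (r : Fin 2 × Fin (n + 1)) :
    (xyKron n - (joint B).map MvPolynomial.C).mulVec p r
      = MvPolynomial.X r.1 * p r.2 - act (B r.1) p r.2 := by
  rw [Matrix.sub_mulVec, Pi.sub_apply]
  congr 1
  · simp [xyKron, Matrix.mulVec, dotProduct, Matrix.one_apply]

/-! ### The monic family of solutions, its matrices and its recursion -/

section Families

variable {q a b c d : ℝ}

theorem isEigenFamily_iff (hq : 0 < q) (hq1 : q ≠ 1) (hd : d ≠ 0) (P : PolyVecFamily) :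
    IsMonicFamily P ∧ IsSolutionFamily q a b c d P ↔ IsEigenFamily q a b c d P := by
  have h₁ : IsMonicFamily P ↔ ∀ (n : ℕ) (k : Fin (n + 1)), DegLT (P n k - mono (n - k) k) n := by
    refine forall_congr' fun n => forall_congr' fun k => ?_
    rw [← mono_eq]
    constructor
    · intro h m l hml
      by_contra hne
      have := h (expo m l) (MvPolynomial.mem_support_iff.2 hne)
      rw [expo_zero, expo_one] at this
      omega
    · intro h e he
      by_contra hlt
      rw [MvPolynomial.mem_support_iff, eq_expo e] at he
      exact he (h _ _ (not_lt.1 hlt))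
  have h₂ : IsSolutionFamily q a b c d P ↔
      ∀ (n : ℕ) (k : Fin (n + 1)), sOp q a b c d n (P n k) = 0 := by
    refine forall_congr' fun n => forall_congr' fun k => ?_
    rw [sOp_eq_zero_iff, ← solution_iff a b c d hq hq1 hd]
  rw [h₁, h₂]
  have h₃ (n : ℕ) (k : Fin (n + 1)) : n - (k : ℕ) + k = n := by omega
  constructor
  · intro h n k
    refine ⟨?_, ?_⟩
    · rw [h₃]; exact h.1 n k
    · rw [h₃]; exact h.2 n k
  · intro h
    refine ⟨fun n k => ?_, fun n k => ?_⟩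
    · have := (h n k).degLT
      rwa [h₃] at this
    · have := (h n k).sOp_eq
      rwa [h₃] at this

namespace IsEigenFamily

variable {P : PolyVecFamily} (hP : IsEigenFamily q a b c d P)
include hP

theorem sum_eq_zero {n : ℕ} (t : Fin (n + 1) → ℝ)
    (h : ∀ m l, m + l = n → cf (∑ i, t i • P n i) m l = 0) : t = 0 := by
  ext i
  have h₁ := h (n - i) i (by omega)
  -- The coefficient of `x^(n-i) y^i` in the combination is `t i`. The extension of `t` by `0` only
  -- serves to have a function on `ℕ`.
  have h₂ := hP.cf_sum_top (n := n) (fun j => if hj : j < n + 1 then t ⟨j, hj⟩ else 0)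
    (m := n - i) (l := i) (by omega)
  simp only [Fin.is_lt, dite_true, Fin.eta] at h₂
  rw [h₁, if_pos (by omega)] at h₂
  exact h₂.symm

theorem cf_act_of_lt {ι : Type} {n : ℕ} (M : Matrix ι (Fin (n + 1)) ℝ) (i : ι) {m l : ℕ}
    (h : n < m + l) : cf (act M (P n) i) m l = 0 := by
  rw [act_apply, cf_sum]
  refine Finset.sum_eq_zero fun j _ => ?_
  rw [cf_smul, (hP n j).cf_top (by omega), if_neg (by omega), mul_zero]

theorem act_eq_zero {n : ℕ} {ι : Type} (M : Matrix ι (Fin (n + 1)) ℝ)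
    (h : ∀ i m l, m + l = n → cf (act M (P n) i) m l = 0) : M = 0 := by
  ext i j
  have h₁ := hP.sum_eq_zero (M i) (fun m l hml => by rw [← act_apply]; exact h i m l hml)
  exact congrFun h₁ j

/-- The parts of degree `n + 1`, `n` and `n - 1` are examined in turn. In each, the leading
monomials of the remaining top vector are distinct. -/
theorem act_independent {n : ℕ} {ι : Type} (A : Matrix ι (Fin (n + 2)) ℝ)
    (B : Matrix ι (Fin (n + 1)) ℝ) (G : Matrix ι (Fin n) ℝ)
    (h : act A (P (n + 1)) + act B (P n) + act G (prevVec P n) = 0) : A = 0 ∧ B = 0 ∧ G = 0 := by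
  have hG (i : ι) {m l : ℕ} (hml : n ≤ m + l) : cf (act G (prevVec P n) i) m l = 0 := by
    rcases n with _ | n
    · rw [act_apply, Finset.sum_of_isEmpty, cf_zero]
    · exact hP.cf_act_of_lt G i (by omega)
  have hc (i : ι) (m l : ℕ) : cf (act A (P (n + 1)) i) m l + cf (act B (P n) i) m l
      + cf (act G (prevVec P n) i) m l = 0 := by
    have := congrArg (fun p => cf p m l) (congrFun h i)
    simpa only [Pi.add_apply, cf_add, Pi.zero_apply, cf_zero] using this
  have hA : A = 0 := hP.act_eq_zero A fun i m l hml => by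
    have := hc i m l
    rwa [hP.cf_act_of_lt B i (by omega), hG i (by omega), add_zero, add_zero] at this
  have hA' (i : ι) (m l : ℕ) : cf (act A (P (n + 1)) i) m l = 0 := by
    simp [hA, act_apply, cf_zero]
  have hB : B = 0 := hP.act_eq_zero B fun i m l hml => by
    have := hc i m l
    rwa [hA', hG i (by omega), zero_add, add_zero] at this
  have hB' (i : ι) (m l : ℕ) : cf (act B (P n) i) m l = 0 := by
    simp [hB, act_apply, cf_zero]
  refine ⟨hA, hB, ?_⟩
  rcases n with _ | n
  · ext i j
    exact j.elim0
  · refine hP.act_eq_zero G fun i m l hml => ?_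
    have := hc i m l
    rwa [hA', hB', zero_add, zero_add] at this

end IsEigenFamily

variable (q a b c d) in
/-- The matrices `B_{n,v+1}`. -/
def bMat (v : Fin 2) (n : ℕ) : Matrix (Fin (n + 1)) (Fin (n + 1)) ℝ :=
  Matrix.of fun k l => bEntry q a b c d v n k l

variable (q a b c d) in
/-- The matrices `C_{n,v+1}`. -/
def cMat (v : Fin 2) (n : ℕ) : Matrix (Fin (n + 1)) (Fin n) ℝ :=
  Matrix.of fun k l => cEntry q a b c d v n k l

namespace IsEigenFamily

variable {P : PolyVecFamily} (hP : IsEigenFamily q a b c d P) (hq0 : 0 < q) (hq1 : q < 1)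
  (hs : ∀ N, 3 ≤ N → a * b * c * q ^ N ≠ 1) (ha : a ≠ 0) (hc : c ≠ 0) (hd : d ≠ 0)
include hP hq0 hq1 hs ha hc hd

theorem isRecurrence (v : Fin 2) (n : ℕ) :
    IsRecurrence P v n (shiftL v n) (bMat q a b c d v n) (cMat q a b c d v n) := by
  funext k
  rw [Pi.add_apply, Pi.add_apply, act_shiftL, act_apply, act_apply,
    hP.recurrence hq0 hq1 hs ha hc hd]
  rfl

theorem isRecurrence_iff (v : Fin 2) (n : ℕ) (A : Matrix (Fin (n + 1)) (Fin (n + 2)) ℝ)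
    (B : Matrix (Fin (n + 1)) (Fin (n + 1)) ℝ) (G : Matrix (Fin (n + 1)) (Fin n) ℝ) :
    IsRecurrence P v n A B G ↔
      A = shiftL v n ∧ B = bMat q a b c d v n ∧ G = cMat q a b c d v n := by
  have h₀ := hP.isRecurrence hq0 hq1 hs ha hc hd v n
  constructor
  · intro h
    have h₁ := hP.act_independent (A - shiftL v n) (B - bMat q a b c d v n)
      (G - cMat q a b c d v n) (by
        rw [IsRecurrence] at h h₀
        rw [h] at h₀
        ext1 k
        have h₂ := congrFun h₀ k
        simp only [Pi.add_apply, act_apply, Matrix.sub_apply, sub_smul,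
          Finset.sum_sub_distrib, Pi.zero_apply] at h₂ ⊢
        rw [← sub_eq_zero] at h₂
        rw [← h₂]
        abel)
    exact ⟨sub_eq_zero.1 h₁.1, sub_eq_zero.1 h₁.2.1, sub_eq_zero.1 h₁.2.2⟩
  · rintro ⟨rfl, rfl, rfl⟩
    exact h₀

/-- Stacking both recurrences and multiplying by the left inverse `Ddag n` isolates `P (n + 1)`.
Conversely the recursion determines each vector from the two before it. -/
theorem isComputedRecursively_iff (Q : PolyVecFamily) :
    IsComputedRecursively (fun v n => bMat q a b c d v n) (fun v n => cMat q a b c d v n) Q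
      ↔ Q = P := by
  have h₀ : IsComputedRecursively (fun v n => bMat q a b c d v n)
      (fun v n => cMat q a b c d v n) P := by
    constructor
    · ext1 k
      refine cf_ext fun m l => ?_
      rw [(hP 0 k).cf_top (by omega), show (1 : MvPolynomial (Fin 2) ℝ) = mono 0 0 by simp [mono_eq],
        cf_mono]
      simp
    · intro n
      have h₁ : (xyKron n - (joint fun v => bMat q a b c d v n).map MvPolynomial.C).mulVec (P n)
          = act (joint fun v => shiftL v n) (P (n + 1))
            + act (joint fun v => cMat q a b c d v n) (prevVec P n) := by
        ext1 r
        have h₂ := congrFun (hP.isRecurrence hq0 hq1 hs ha hc hd r.1 n) r.2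
        simp only [Pi.add_apply] at h₂
        rw [xyKron_sub_mulVec, Pi.add_apply, act_joint, act_joint, h₂]
        abel
      rw [h₁, act_add, act_act, act_act, Ddag_mul_joint, act_one]
      abel
  constructor
  · intro h
    have h₁ (n : ℕ) : Q n = P n ∧ prevVec Q n = prevVec P n := by
      induction n with
      | zero => exact ⟨h.1.trans h₀.1.symm, funext fun i => i.elim0⟩
      | succ n ih =>
        refine ⟨?_, ih.1⟩
        rw [h.2 n, h₀.2 n, ih.1, ih.2]
    exact funext fun n => (h₁ n).1
  · rintro rfl
    exact h₀

end IsEigenFamily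

end Families

/-! ### The displayed entries -/

section Entries

variable {q a b c d : ℝ}

theorem entryB_eq (hq0 : 0 < q) (hq1 : q < 1) (v : Fin 2) {n k : ℕ} (hk : k ≤ n) (l : ℕ)
    (h₁ : a * b * c * q ^ (2 * n + 1) ≠ 1) (h₃ : a * b * c * q ^ (2 * n + 3) ≠ 1) :
    entryB q a b c d v n ((k : ℕ) + 1) ((l : ℕ) + 1) = bEntry q a b c d v n k l := by
  have hq := hq0.ne'
  have hq' : q - 1 ≠ 0 := (sub_neg.2 hq1).ne
  obtain ⟨m, rfl⟩ : ∃ m, n = m + k := ⟨n - k, by omega⟩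
  have h₁' : a * b * c * q ^ (2 * ((m : ℤ) + k) + 1) - 1 ≠ 0 := sub_ne_zero.2 (mod_cast h₁)
  have h₃' : a * b * c * q ^ (2 * ((m : ℤ) + k) + 3) - 1 ≠ 0 := sub_ne_zero.2 (mod_cast h₃)
  rw [Nat.cast_add, bEntry, entryB, Nat.add_sub_cancel]
  split_ifs with hv h₄ h₄ h₄ h₄
  · rw [h₄, entryB1_diag _ _ _ _ hq hq' _ _ h₁' h₃', zpow_natCast, zpow_natCast]
  · rw [show ((l : ℤ) + 1) = k by omega, entryB1_sub _ _ _ _ hq hq' _ _ h₁' h₃', zpow_natCast,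
      zpow_natCast]
  · rw [entryB1, if_neg (by omega), if_neg (by omega)]
  · rw [h₄, entryB2_diag _ _ _ _ hq hq' _ _ h₁' h₃', zpow_natCast, zpow_natCast]
  · rw [show ((l : ℤ) + 1) = k + 2 by omega, entryB2_sup _ _ _ _ hq hq' _ _ h₁' h₃',
      zpow_natCast, zpow_natCast]
  · rw [entryB2, if_neg (by omega), if_neg (by omega)]

theorem qPoch_ne_zero (hq0 : 0 < q) (hq1 : q < 1) (k : ℕ) : qPoch q q k ≠ 0 := by
  refine Finset.prod_ne_zero_iff.2 fun j _ => ?_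
  have : q * q ^ j < 1 := by
    rw [← pow_succ']; exact pow_lt_one₀ hq0.le hq1 (Nat.succ_ne_zero j)
  linarith

theorem qPoch_add_two (hq : q ≠ 0) (k : ℕ) :
    qPoch q q (k + 2) = qPoch q q k * ((1 - q ^ (k + 2) / q) * (1 - q ^ (k + 2))) := by
  rw [qPoch, Finset.prod_range_succ, Finset.prod_range_succ, qPoch, mul_assoc]
  congr 2
  · rw [pow_add]; field_simp
  · rw [pow_add, pow_add]; ring

theorem entryC_eq (hq0 : 0 < q) (hq1 : q < 1) (v : Fin 2) {n k l : ℕ} (hk : k ≤ n) (hl : l < n)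
    (h₀ : a * b * c * q ^ (2 * n) ≠ 1)
    (h₁ : a * b * c * q ^ (2 * n + 1) ≠ 1) (h₂ : a * b * c * q ^ (2 * n + 2) ≠ 1)
    (h₃ : a * b * c * q ^ (2 * n + 3) ≠ 1) :
    entryC q a b c d v n ((k : ℕ) + 1) ((l : ℕ) + 1) = cEntry q a b c d v n k l := by
  have hq := hq0.ne'
  have hq' : q - 1 ≠ 0 := (sub_neg.2 hq1).ne
  have hq'' : q + 1 ≠ 0 := by positivity
  obtain ⟨m, rfl⟩ : ∃ m, n = m + k := ⟨n - k, by omega⟩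
  have h₀' : a * b * c * q ^ (2 * ((m : ℤ) + k)) - 1 ≠ 0 := sub_ne_zero.2 (mod_cast h₀)
  have h₁' : a * b * c * q ^ (2 * ((m : ℤ) + k) + 1) - 1 ≠ 0 := sub_ne_zero.2 (mod_cast h₁)
  have h₂' : a * b * c * q ^ (2 * ((m : ℤ) + k) + 2) - 1 ≠ 0 := sub_ne_zero.2 (mod_cast h₂)
  have h₃' : a * b * c * q ^ (2 * ((m : ℤ) + k) + 3) - 1 ≠ 0 := sub_ne_zero.2 (mod_cast h₃)
  rw [Nat.cast_add, cEntry, entryC, Nat.add_sub_cancel]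
  split_ifs with hv h₄ h₄ h₅ h₄ h₄ h₅
  · rw [h₄, entryC1_diag _ _ _ _ hq hq' hq'' _ _ h₀' h₁' h₂' h₃', zpow_natCast, zpow_natCast]
  · rw [show ((l : ℤ) + 1) = k by omega, entryC1_sub _ _ _ _ hq hq' hq'' _ _ h₀' h₁' h₂' h₃',
      zpow_natCast, zpow_natCast]
  · subst h₅
    rw [show ((l : ℤ) + 1) = ((l + 2 : ℕ) : ℤ) - 1 by omega,
      entryC1_sub_sub _ _ _ _ hq hq' hq'' _ _ h₀' h₁' h₂' h₃' (qPoch_ne_zero hq0 hq1 _) ?_,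
      zpow_natCast, zpow_natCast]
    rw [show (((l + 2 : ℕ) : ℤ) + 1 - 1).toNat = l + 2 by omega,
      show (((l + 2 : ℕ) : ℤ) + 1 - 3).toNat = l by omega, zpow_natCast]
    exact qPoch_add_two hq l
  · rw [entryC1, if_neg (by omega), if_neg (by omega), if_neg (by omega)]
  · rw [h₄, entryC2_diag _ _ _ _ hq hq' hq'' _ _ h₀' h₁' h₂' h₃', zpow_natCast, zpow_natCast]
  -- The column bound `l < n` with `l = k + 1` forces `m ≥ 2`, so the truncated arguments of `qPoch`
  -- are the true ones.
  · obtain ⟨m, rfl⟩ : ∃ m', m = m' + 2 := ⟨m - 2, by omega⟩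
    rw [show ((l : ℤ) + 1) = k + 2 by omega,
      entryC2_sup _ _ _ _ hq hq' hq'' _ _ h₀' h₁' h₂' h₃' (qPoch_ne_zero hq0 hq1 _) ?_,
      zpow_natCast, zpow_natCast]
    rw [show (((m + 2 : ℕ) : ℤ) + k - (k + 1) + 1).toNat = m + 2 by omega,
      show (((m + 2 : ℕ) : ℤ) + k - (k + 1) - 1).toNat = m by omega, zpow_natCast]
    exact qPoch_add_two hq m
  · rw [show ((l : ℤ) + 1) = k by omega, entryC2_sub _ _ _ _ hq hq' hq'' _ _ h₀' h₁' h₂' h₃',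
      zpow_natCast, zpow_natCast]
  · rw [entryC2, if_neg (by omega), if_neg (by omega), if_neg (by omega)]

/-! ### Continuity in the parameter `c` -/

theorem eventually_ne_one (hq : q ≠ 0) (ha : a ≠ 0) (hb : b ≠ 0) (N : ℕ) :
    ∀ᶠ c' in 𝓝[≠] c, a * b * c' * q ^ N ≠ 1 := by
  by_cases h : a * b * c * q ^ N = 1
  · filter_upwards [self_mem_nhdsWithin] with c' hc' h'
    apply hc'
    have h₁ : a * b * q ^ N * (c' - c) = 0 := by linear_combination h' - h
    have h₂ : a * b * q ^ N ≠ 0 := mul_ne_zero (mul_ne_zero ha hb) (pow_ne_zero _ hq)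
    exact sub_eq_zero.1 ((mul_eq_zero.1 h₁).resolve_left h₂)
  · have h₁ : ContinuousAt (fun c' => a * b * c' * q ^ N) c := by fun_prop
    exact nhdsWithin_le_nhds (h₁.eventually_ne h)

theorem continuousAt_g1 {X Y : ℝ}
    (h : mEig q a b c (X * Y) - mEig q a b c (X * Y / q) ≠ 0) :
    ContinuousAt (fun c' => g1 q a b c' d X Y) c := by
  refine ContinuousAt.div ?_ ?_ h
  · unfold w1; fun_prop
  · unfold mEig; fun_prop

theorem continuousAt_g2 {X Y : ℝ}
    (h : mEig q a b c (X * Y) - mEig q a b c (X * Y / q) ≠ 0) :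
    ContinuousAt (fun c' => g2 q a b c' d X Y) c := by
  refine ContinuousAt.div ?_ ?_ h
  · unfold w2; fun_prop
  · unfold mEig; fun_prop

theorem continuousAt_h {X Y : ℝ}
    (h : mEig q a b c (X * Y) - mEig q a b c (X * Y / q) ≠ 0)
    (h' : mEig q a b c (X * Y) - mEig q a b c (X * Y / q ^ 2) ≠ 0) :
    ContinuousAt (fun c' => h11 q a b c' d X Y) c ∧
    ContinuousAt (fun c' => h12 q a b c' d X Y) c ∧
    ContinuousAt (fun c' => h22 q a b c' d X Y) c := by
  have h₁ := continuousAt_g1 (d := d) h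
  have h₂ := continuousAt_g2 (d := d) h
  have h₃ : ContinuousAt
      (fun c' => mEig q a b c' (X * Y) - mEig q a b c' (X * Y / q ^ 2)) c := by
    unfold mEig; fun_prop
  refine ⟨ContinuousAt.div ?_ h₃ h', ContinuousAt.div ?_ h₃ h', ContinuousAt.div ?_ h₃ h'⟩
  · unfold w11 w1; fun_prop
  · unfold w12 w1 w2; fun_prop
  · unfold w22 w2; fun_prop

/-- The denominator `Δ_1` occurs only in `g1` and `g2` at `X = Y = 1`, whose numerators vanish for
every `c'`. The other terms have the denominator `Δ_3`, which is nonzero at `c`. -/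
theorem continuousAt_bEntry_zero (hq0 : 0 < q) (hq1 : q < 1)
    (hs : ∀ N, 3 ≤ N → a * b * c * q ^ N ≠ 1) (v : Fin 2) :
    ContinuousAt (fun c' => bEntry q a b c' d v 0 0 0) c := by
  have hq := hq0.ne'
  have hne := mEig_ne (i := 1) (j := 0) hq0 hq1 hs one_ne_zero
  have h₁ (c' : ℝ) : g1 q a b c' d 1 1 = 0 := by simp [g1, w1]
  have h₂ (c' : ℝ) : g2 q a b c' d 1 1 = 0 := by simp [g2, w2]
  have e : q / q = 1 := div_self hq
  simp only [bEntry, if_true, Nat.sub_self, pow_zero, bX0, bY0, h₁, h₂, mul_one, zero_sub]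
  split_ifs
  · exact (continuousAt_g1 (by simpa [e] using hne)).neg
  · exact (continuousAt_g2 (by simpa [e] using hne)).neg

theorem continuousAt_cEntry_one (hq0 : 0 < q) (hq1 : q < 1)
    (hs : ∀ N, 3 ≤ N → a * b * c * q ^ N ≠ 1) (v : Fin 2) {k : ℕ} (hk : k < 2) :
    ContinuousAt (fun c' => cEntry q a b c' d v 1 k 0) c := by
  have hq := hq0.ne'
  have hD {X Y : ℝ} (n : ℕ) (h : X * Y = q ^ (n + 1)) :
      mEig q a b c (X * Y) - mEig q a b c (X * Y / q) ≠ 0 := by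
    rw [h, show q ^ (n + 1) / q = q ^ n by rw [pow_succ]; field_simp]
    exact mEig_ne hq0 hq1 hs (by omega)
  have hE {X Y : ℝ} (n : ℕ) (h : X * Y = q ^ (n + 2)) :
      mEig q a b c (X * Y) - mEig q a b c (X * Y / q ^ 2) ≠ 0 := by
    rw [h, show q ^ (n + 2) / q ^ 2 = q ^ n by rw [pow_add]; field_simp]
    exact mEig_ne hq0 hq1 hs (by omega)
  have g1c {X Y : ℝ} (n : ℕ) (h : X * Y = q ^ (n + 1)) :=
    continuousAt_g1 (d := d) (hD n h)
  have g2c {X Y : ℝ} (n : ℕ) (h : X * Y = q ^ (n + 1)) :=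
    continuousAt_g2 (d := d) (hD n h)
  have hc {X Y : ℝ} (h : X * Y = q ^ 2) :=
    continuousAt_h (d := d) (hD 1 h) (hE 0 h)
  -- The denominator `Δ_2` belongs to the coefficients two degrees below a polynomial of degree `1`.
  -- Their numerators vanish for every `c'`, so the singular terms drop out before continuity is
  -- used.
  have h11_zero (c' : ℝ) : h11 q a b c' d q 1 = 0 := by simp [h11, w11, w1, hq]
  have h12_zero (c' : ℝ) : h12 q a b c' d q 1 = 0 := by simp [h12, w12, w2, g2]
  have h12_zero' (c' : ℝ) : h12 q a b c' d 1 q = 0 := by simp [h12, w12, w1, g1]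
  have h22_zero (c' : ℝ) : h22 q a b c' d 1 q = 0 := by simp [h22, w22, w2, hq]
  interval_cases k
  · simp only [cEntry, if_true, Nat.sub_zero, pow_one, pow_zero, cX0, cY0, bX0, bY0, bY1, h11_zero,
      h12_zero, zero_sub, div_self hq, mul_one]
    split_ifs
    · exact ((hc (by ring)).1.neg).sub
        (((g1c 0 (by ring)).sub (g1c 1 (by ring))).mul (g1c 0 (by ring)))
    · exact ((hc (by ring)).2.1.neg.sub
        (((g2c 0 (by ring)).sub (g2c 1 (by ring))).mul (g1c 0 (by ring)))).sub
        (((g1c 0 (by ring)).sub (g1c 1 (by ring))).mul (g2c 0 (by ring)))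
  · simp only [cEntry, if_true, Nat.sub_self, zero_ne_one, if_false, zero_add, pow_one, pow_zero,
      cX1, cY2, bX0, bX1, bY0, h12_zero', h22_zero, zero_sub, div_self hq, mul_one,
      show ¬ (0 = 1 + 1) by omega]
    split_ifs
    · exact ((hc (by ring)).2.1.neg.sub
        (((g1c 0 (by ring)).sub (g1c 1 (by ring))).mul (g2c 0 (by ring)))).sub
        (((g2c 0 (by ring)).sub (g2c 1 (by ring))).mul (g1c 0 (by ring)))
    · exact (hc (by ring)).2.2.neg.sub
        (((g2c 0 (by ring)).sub (g2c 1 (by ring))).mul (g2c 0 (by ring)))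

end Entries

end BigQJacobi

end

/-! ### The main theorem -/

open BigQJacobi in
theorem mainTheorem8 (q a b c d : ℝ) (hq0 : 0 < q) (hq1 : q < 1)
    (ha0 : 0 < a * q) (ha1 : a * q < 1) (hb0 : 0 < b * q) (hb1 : b * q < 1)
    (hc0 : 0 < c * q) (hc1 : c * q < 1) (hd : d < 0) :
    ∃ (P : PolyVecFamily)
      (B : Fin 2 → (n : ℕ) → Matrix (Fin (n + 1)) (Fin (n + 1)) ℝ)
      (G : Fin 2 → (n : ℕ) → Matrix (Fin (n + 1)) (Fin n) ℝ),
      -- `P` is the one and only monic family of solutions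
      (∀ Q : PolyVecFamily, IsMonicFamily Q ∧ IsSolutionFamily q a b c d Q ↔ Q = P) ∧
      -- `L`, `B` and `G` are the one and only matrices of its three-term recurrence relations
      (∀ (v : Fin 2) (n : ℕ) (A : Matrix (Fin (n + 1)) (Fin (n + 2)) ℝ)
        (B' : Matrix (Fin (n + 1)) (Fin (n + 1)) ℝ) (G' : Matrix (Fin (n + 1)) (Fin n) ℝ),
        IsRecurrence P v n A B' G' ↔ A = shiftL v n ∧ B' = B v n ∧ G' = G v n) ∧
      -- the entries of `B`; the second line concerns a removable singularity, only for `n = 0`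
      (∀ (v : Fin 2) (n : ℕ) (i j : Fin (n + 1)),
        (a * b * c * q ^ (2 * n + 1) ≠ 1 →
          B v n i j = entryB q a b c d v n ((i : ℕ) + 1) ((j : ℕ) + 1)) ∧
        (a * b * c * q ^ (2 * n + 1) = 1 →
          Tendsto (fun c' => entryB q a b c' d v n ((i : ℕ) + 1) ((j : ℕ) + 1))
            (𝓝[≠] c) (𝓝 (B v n i j)))) ∧
      -- the entries of `G`; the second line concerns a removable singularity, only for `n = 1`
      (∀ (v : Fin 2) (n : ℕ) (i : Fin (n + 1)) (j : Fin n),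
        (a * b * c * q ^ (2 * n) ≠ 1 →
          G v n i j = entryC q a b c d v n ((i : ℕ) + 1) ((j : ℕ) + 1)) ∧
        (a * b * c * q ^ (2 * n) = 1 →
          Tendsto (fun c' => entryC q a b c' d v n ((i : ℕ) + 1) ((j : ℕ) + 1))
            (𝓝[≠] c) (𝓝 (G v n i j)))) ∧
      -- `P` is what the recursive formula computes
      (∀ n : ℕ, Ddag n * (joint fun v => shiftL v n) = 1) ∧
      (∀ Q : PolyVecFamily, IsComputedRecursively B G Q ↔ Q = P) := by
  have hq := hq0.ne'
  have ha : a ≠ 0 := fun h => by simp [h] at ha0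
  have hb : b ≠ 0 := fun h => by simp [h] at hb0
  have hc : c ≠ 0 := fun h => by simp [h] at hc0
  have hs : ∀ N, 3 ≤ N → a * b * c * q ^ N ≠ 1 := by
    intro N hN
    obtain ⟨r, rfl⟩ := Nat.exists_eq_add_of_le hN
    -- Three powers of `q` suffice to make each of `a`, `b`, `c` smaller than `1`. This is why only
    -- the exponents below `3` can be singular.
    have h₁ : a * b * c * q ^ (3 + r) = (a * q) * (b * q) * (c * q) * q ^ r := by ring
    have h₂ : (a * q) * (b * q) < 1 := mul_lt_one_of_nonneg_of_lt_one_left ha0.le ha1 hb1.le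
    have h₃ : (a * q) * (b * q) * (c * q) < 1 :=
      mul_lt_one_of_nonneg_of_lt_one_left (mul_pos ha0 hb0).le h₂ hc1.le
    rw [h₁]
    exact (mul_lt_one_of_nonneg_of_lt_one_left (by positivity) h₃
      (pow_le_one₀ hq0.le hq1.le)).ne
  choose P hP using fun (n : ℕ) (k : Fin (n + 1)) =>
    exists_monic_eigenvector (a := a) (b := b) (c := c) d hq0 hq1 hs (n - k) k
  have hP' : IsEigenFamily q a b c d P := fun n k => ⟨(hP n k).1, (hP n k).2⟩
  refine ⟨P, fun v n => bMat q a b c d v n, fun v n => cMat q a b c d v n, fun Q => ?_,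
    hP'.isRecurrence_iff hq0 hq1 hs ha hc hd.ne, fun v n i j => ⟨fun h => ?_, fun h => ?_⟩,
    fun v n i j => ⟨fun h => ?_, fun h => ?_⟩, Ddag_mul_joint,
    hP'.isComputedRecursively_iff hq0 hq1 hs ha hc hd.ne⟩
  · rw [isEigenFamily_iff hq0 hq1.ne hd.ne]
    refine ⟨fun hQ => ?_, fun h => h ▸ hP'⟩
    ext1 n
    ext1 k
    exact (hQ n k).eq hq0 hq1 hs (hP' n k)
  · exact (entryB_eq hq0 hq1 v (by omega) j h (hs _ (by omega))).symm
  · obtain rfl : n = 0 := by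
      by_contra hn
      exact hs _ (by omega) h
    obtain rfl : i = 0 := Fin.ext (by omega)
    obtain rfl : j = 0 := Fin.ext (by omega)
    -- For `c'` near but different from `c` the displayed entry equals `bEntry`, which is continuous
    -- at `c`.
    refine Tendsto.congr' ?_ ((continuousAt_bEntry_zero (d := d) hq0 hq1 hs v).tendsto.mono_left
      nhdsWithin_le_nhds)
    filter_upwards [eventually_ne_one hq ha hb (2 * 0 + 1),
      eventually_ne_one hq ha hb (2 * 0 + 3)] with c' h₁ h₃
    exact (entryB_eq hq0 hq1 v le_rfl 0 h₁ h₃).symm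
  · have hj := j.2
    exact (entryC_eq hq0 hq1 v (by omega) hj h (hs (2 * n + 1) (by omega))
      (hs (2 * n + 2) (by omega)) (hs (2 * n + 3) (by omega))).symm
  -- A column index exists only for `n ≥ 1`, and `2 * n ≥ 3` is excluded by `hs`.
  · obtain rfl : n = 1 := by
      by_contra hn
      have := j.2
      exact hs _ (by omega) h
    obtain rfl : j = 0 := Subsingleton.elim ..
    refine Tendsto.congr' ?_ ((continuousAt_cEntry_one (d := d) hq0 hq1 hs v i.2).tendsto.mono_left
      nhdsWithin_le_nhds)
    filter_upwards [eventually_ne_one hq ha hb (2 * 1), eventually_ne_one hq ha hb (2 * 1 + 1),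
      eventually_ne_one hq ha hb (2 * 1 + 2), eventually_ne_one hq ha hb (2 * 1 + 3)]
      with c' h₀ h₁ h₂ h₃
    exact (entryC_eq hq0 hq1 v (by omega) Nat.one_pos h₀ h₁ h₂ h₃).symm
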